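/- Let $\frac12<\alpha<1$, $T>0$, $J=[0,T]$. Let $\mathbb X$ be a real separable reflexive Banach space whose dual $\mathbb X^*$ is strictly convex, $\mathbb U$ a real separable Hilbert space (identified with its dual), $\mathrm A$ the infinitesimal generator of a $C_0$-semigroup $\mathcal T(t)$, $t\ge 0$, on $\mathbb X$, and $\mathrm B:\mathbb U\to\mathbb X$ bounded and linear. For $\xi>0$ put $$\phi_\alpha(\xi)=\frac1\pi\sum_{n=1}^\infty(-1)^{n-1}\xi^{-n\alpha-1}\frac{\Gamma(n\alpha+1)}{n!}\sin(n\pi\alpha),\qquad \varphi_\alpha(\xi)=\tfrac1\alpha\,\xi^{-1-1/\alpha}\phi_\alpha(\xi^{-1/\alpha}),$$ and for $t\ge0$, $x\in\mathbb X$, $$\mathcal T_\alpha(t)x=\int_0^\infty\varphi_\alpha(\xi)\,\mathcal T(t^\alpha\xi)x\,d\xi,\qquad \widehat{\mathcal T}_\alpha(t)x=\alpha\int_0^\infty\xi\varphi_\alpha(\xi)\,\mathcal T(t^\alpha\xi)x\,d\xi .$$ Consider the linear fractional control system ${}^CD^\alpha_{0,t}x(t)=\mathrm Ax(t)+\mathrm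 Bu(t)$, $t\in J$, $x(0)=\zeta$, where $\zeta\in\mathbb X$ and $u\in L^2(J;\mathbb U)$; its mild solution is the function $x(\cdot;\zeta,u)\in C(J;\mathbb X)$ given by $$x(t)=\mathcal T_\alpha(t)\zeta+\int_0^t(t-s)^{\alpha-1}\widehat{\mathcal T}_\alpha(t-s)\mathrm Bu(s)\,ds .$$ The system is approximately controllable on $J$ from $\zeta$ if $\{x(T;\zeta,u):u\in L^2(J;\mathbb U)\}$ is dense in $\mathbb X$, and approximately controllable on $J$ if this holds for every $\zeta\in\mathbb X$. Let $\mathcal J[x]=\{x^*\in\mathbb X^*:\langle x,x^*\rangle=\|x\|^2=\|x^*\|^2\}$ be the duality mapping and $$\Phi_0^Tx^*=\int_0^T(T-t)^{2(\alpha-1)}\widehat{\mathcal T}_\alpha(T-t)\mathrm B\mathrm B^*\widehat{\mathcal T}_\alpha(T-t)^*x^*\,dt,\qquad x^*\in\mathbb X^*.$$ Then each $\widehat{\mathcal T}_\alpha(t)$, $t\ge 0$, is a well-defined bounded linear operator (the defining integral converges absolutely); for every $\lambda>0$ and $h\in\mathbb X$ the equation $\lambda w+\Phi_0^T\mathcal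 J[w]=h$ has exactly one solution $w=:\mathcal R(\lambda,\Phi_0^T)h\in\mathbb X$; and the following are equivalent: 1. the system is approximately controllable on $J$; 2. (H0): for every $h\in\mathbb X$, $\lambda\mathcal R(\lambda,\Phi_0^T)h\to0$ in norm as $\lambda\downarrow0$; 3. for every $x^*\in\mathbb X^*$: if $\mathrm B^*\widehat{\mathcal T}_\alpha(T-t)^*x^*=0$ for all $0\le t<T$, then $x^*=0$. Moreover, for each fixed $\zeta\in\mathbb X$, the system is approximately controllable on $J$ from $\zeta$ if and only if (H0) holds. -/

import Mathlib

open MeasureTheory Filter Topology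

noncomputable section

namespace FracControl

/-- The one-sided stable probability density
`ϕ_q(ξ) = (1/π) ∑_{n ≥ 1} (-1)^{n-1} ξ^{-nq-1} Γ(nq+1)/n! sin(nπq)` (the sum over `n ≥ 1` is
written as a sum over `n + 1`, `n ≥ 0`); used for `0 < q < 1` and `ξ > 0` only. -/
def stableDensity (q ξ : ℝ) : ℝ :=
  (1 / Real.pi) * ∑' n : ℕ, (-1 : ℝ) ^ n * ξ ^ (-((n + 1 : ℝ) * q) - 1) *
    (Real.Gamma ((n + 1 : ℝ) * q + 1) / ((n + 1).factorial : ℝ)) *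
    Real.sin ((n + 1 : ℝ) * Real.pi * q)

/-- The density `φ_q(ξ) = (1/q) ξ^{-1-1/q} ϕ_q(ξ^{-1/q})` on `(0, ∞)`. -/
def subordDensity (q ξ : ℝ) : ℝ :=
  (1 / q) * ξ ^ (-1 - 1 / q) * stableDensity q (ξ ^ (-(1 / q)))

section Semigroup

variable {X : Type*} [NormedAddCommGroup X] [NormedSpace ℝ X]

/-- `S` is a `C₀`-semigroup of bounded linear operators on `X`; only the values `S t` with
`t ≥ 0` are meaningful. -/
structure IsC0Semigroup (S : ℝ → X →L[ℝ] X) : Prop where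
  map_zero : S 0 = ContinuousLinearMap.id ℝ X
  map_add : ∀ s t : ℝ, 0 ≤ s → 0 ≤ t → S (s + t) = (S s).comp (S t)
  tendsto_zero : ∀ x : X, Tendsto (fun t => S t x) (𝓝[>] 0) (𝓝 x)

/-- The (unbounded) operator `A` is the infinitesimal generator of `S`: the domain of `A` is the
set of all `x` for which `(S t x - x) / t` converges as `t ↓ 0`, and `A x` is the limit. -/
def IsInfinitesimalGenerator (A : X →ₗ.[ℝ] X) (S : ℝ → X →L[ℝ] X) : Prop :=
  ∀ x y : X, (x, y) ∈ A.graph ↔ Tendsto (fun t : ℝ => t⁻¹ • (S t x - x)) (𝓝[>] 0) (𝓝 y)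

/-- `T_q(t) x = ∫₀^∞ φ_q(ξ) S(t^q ξ) x dξ`. -/
def fracT (S : ℝ → X →L[ℝ] X) (q t : ℝ) (x : X) : X :=
  ∫ ξ in Set.Ioi (0 : ℝ), subordDensity q ξ • S (t ^ q * ξ) x

/-- The vector `q ∫₀^∞ ξ φ_q(ξ) S(t^q ξ) x dξ`. -/
def hatTVec (S : ℝ → X →L[ℝ] X) (q t : ℝ) (x : X) : X :=
  q • ∫ ξ in Set.Ioi (0 : ℝ), (ξ * subordDensity q ξ) • S (t ^ q * ξ) x

open Classical in
/-- The bounded linear operator `T̂_q(t) : x ↦ q ∫₀^∞ ξ φ_q(ξ) S(t^q ξ) x dξ` (the integral is a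
strong one). That this map is linear and bounded for `t ≥ 0` is not built into the definition: it
is asserted in the theorem. -/
def hatT (S : ℝ → X →L[ℝ] X) (q t : ℝ) : X →L[ℝ] X :=
  if h : ∃ L : X →L[ℝ] X, ∀ x, L x = hatTVec S q t x then h.choose else 0

/-- The duality mapping `J[x] = {x* : ⟨x, x*⟩ = ‖x‖² = ‖x*‖²}`. -/
def dualityMap (x : X) : Set (StrongDual ℝ X) :=
  {f | f x = ‖x‖ ^ 2 ∧ ‖f‖ ^ 2 = ‖x‖ ^ 2}

/-- `w` satisfies `λ w + Φ J[w] ∋ h`. -/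
def SolvesResolventEq (Φ : StrongDual ℝ X → X) (lam : ℝ) (h w : X) : Prop :=
  ∃ f ∈ dualityMap w, lam • w + Φ f = h

/-- The (nonlinear) resolvent `R(λ, Φ) = (λ I + Φ J)⁻¹`: `R(λ, Φ) h` is the solution `w` of
`λ w + Φ J[w] = h`. Its unique existence for `λ > 0` is asserted in the theorem. -/
def resolventOp (Φ : StrongDual ℝ X → X) (lam : ℝ) (h : X) : X :=
  Classical.epsilon (SolvesResolventEq Φ lam h)

end Semigroup

section Control

variable {X U : Type*} [NormedAddCommGroup X] [NormedSpace ℝ X]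
  [NormedAddCommGroup U] [InnerProductSpace ℝ U] [CompleteSpace U]

/-- The adjoint `B* : X* → U`, with `U*` identified with the Hilbert space `U`. -/
def adjointB (B : U →L[ℝ] X) (f : StrongDual ℝ X) : U :=
  (InnerProductSpace.toDual ℝ U).symm (f.comp B)

/-- `B* T̂_q(t)* x*`, where `T̂_q(t)* x* = x* ∘ T̂_q(t)`. -/
def obsOp (S : ℝ → X →L[ℝ] X) (B : U →L[ℝ] X) (q t : ℝ) (f : StrongDual ℝ X) : U :=
  adjointB B (f.comp (hatT S q t))

/-- `Φ₀ᵀ x* = ∫₀ᵀ (T-t)^{2(α-1)} T̂_α(T-t) B B* T̂_α(T-t)* x* dt`. -/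
def gramian (S : ℝ → X →L[ℝ] X) (B : U →L[ℝ] X) (α T : ℝ) (f : StrongDual ℝ X) : X :=
  ∫ t in (0 : ℝ)..T, (T - t) ^ (2 * (α - 1)) • hatT S α (T - t) (B (obsOp S B α (T - t) f))

/-- `x ∈ C([0,T]; X)` is the mild solution, with control `u`, of the linear system
`ᶜD^α x = A x + B u` on `[0, T]`, `x(0) = ζ`, where `A` generates `S`. -/
def IsMildSolution (S : ℝ → X →L[ℝ] X) (B : U →L[ℝ] X) (α T : ℝ) (ζ : X) (u : ℝ → U)
    (x : ℝ → X) : Prop :=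
  ContinuousOn x (Set.Icc 0 T) ∧
    ∀ t ∈ Set.Icc (0 : ℝ) T,
      x t = fracT S α t ζ + ∫ s in (0 : ℝ)..t, (t - s) ^ (α - 1) • hatT S α (t - s) (B (u s))

/-- The reachable set at time `T` from `ζ`, with controls in `L²([0,T]; U)`. -/
def reachableSet (S : ℝ → X →L[ℝ] X) (B : U →L[ℝ] X) (α T : ℝ) (ζ : X) : Set X :=
  {y | ∃ (u : ℝ → U) (x : ℝ → X), MemLp u 2 (volume.restrict (Set.Icc 0 T)) ∧
    IsMildSolution S B α T ζ u x ∧ x T = y}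

/-- Approximate controllability on `[0, T]` from the initial state `ζ`. -/
def ApproxControllableFrom (S : ℝ → X →L[ℝ] X) (B : U →L[ℝ] X) (α T : ℝ) (ζ : X) : Prop :=
  closure (reachableSet S B α T ζ) = Set.univ

/-- Approximate controllability on `[0, T]` (for every initial state). -/
def ApproxControllable (S : ℝ → X →L[ℝ] X) (B : U →L[ℝ] X) (α T : ℝ) : Prop :=
  ∀ ζ : X, ApproxControllableFrom S B α T ζ

/-- Assumption (H0): `λ R(λ, Φ₀ᵀ) h → 0` in norm as `λ ↓ 0`, for every `h`. -/
def H0 (S : ℝ → X →L[ℝ] X) (B : U →L[ℝ] X) (α T : ℝ) : Prop :=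
  ∀ h : X, Tendsto (fun lam : ℝ => lam • resolventOp (gramian S B α T) lam h) (𝓝[>] 0) (𝓝 0)

end Control

end FracControl

end

/-!
Up to a constant factor, the density `φ_α(ξ)` is the imaginary part of
`∫ σ ^ (α - 1) e ^ (σ - ξ σ ^ α) dσ` along a ray from the origin into the second quadrant: expanding
the exponential in `ξ` turns this into the series of Gamma values. As the integrand is real on the
positive axis, the imaginary part does not change when the base point of the ray moves to `R > 0`,
and letting `R` be large shows that `φ_α` decays faster than every exponential. Hence
`T̂_α(t) = α ∫ ξ φ_α(ξ) S(t ^ α ξ) dξ` converges absolutely against the exponentially bounded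
semigroup; it is even norm continuous on `t > 0`, because `t` can be moved into the weight by a
dilation, and dilations of the weight are continuous in weighted `L¹`.

Since `α > 1/2`, the kernel `(T - s) ^ (α - 1) T̂_α(T - s) B` is square integrable. `Φ₀ᵀ` is its
Gramian, so that `⟨Φ₀ᵀ f, f⟩ = ∫ ‖(T - s) ^ (α - 1) B* T̂_α(T - s)* f‖² ds`; by Hahn–Banach, the
reachable set is dense iff the range of `Φ₀ᵀ` is dense, iff the integrand vanishes only for `f = 0`.

The equation `λ w + Φ J[w] = h` with `Φ` positive semidefinite is the Euler–Lagrange equation of the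
energy `f ↦ λ/2 ‖f‖² + ½ ⟨Φ f, f⟩ - ⟨h, f⟩`, which is coercive and weak-* lower semicontinuous on
`X*`, so that Banach–Alaoglu gives a minimiser. Uniqueness follows from the monotonicity of `J` and
`Φ` and the strict convexity of `X*`. Pairing the equation with `J[w]` shows that `λ w → 0` as
`λ ↓ 0` whenever the range of `Φ` is dense; conversely `h - λ w` lies in that range.
-/

noncomputable section

namespace FracControl

open scoped Real Nat

open Complex (I)

/-! ### The subordination density -/

theorem summable_pow_mul_factorial_rpow {b : ℝ} (hb : b < 0) {r : ℝ} (hr : 0 ≤ r) :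
    Summable fun n : ℕ => r ^ n * (n ! : ℝ) ^ b := by
  set c := (2 * r) ^ (-b⁻¹) with hc
  have hcb : c ^ b = (2 * r)⁻¹ := by
    rw [hc, ← Real.rpow_mul (by positivity), neg_mul, inv_mul_cancel₀ hb.ne, Real.rpow_neg_one]
  refine Summable.of_nonneg_of_le (fun n => by positivity) (fun n => ?_)
    (summable_geometric_two.mul_right (Real.exp (-b * c)))
  rcases hr.eq_or_lt with rfl | hr
  · rcases n.eq_zero_or_pos with rfl | hn
    · simp [hc, hb.ne, Real.zero_rpow]
    · rw [zero_pow hn.ne', zero_mul]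
      positivity
  have hc0 : 0 < c := by positivity
  have hpow : (c ^ n / n ! : ℝ) ^ (-b) = (2 * r) ^ n * (n ! : ℝ) ^ b := by
    rw [Real.div_rpow (by positivity) (by positivity), ← Real.rpow_natCast_mul hc0.le, mul_comm,
      Real.rpow_mul hc0.le, Real.rpow_neg hc0.le, hcb, inv_inv, Real.rpow_natCast, mul_comm,
      Real.rpow_neg (by positivity), div_inv_eq_mul, mul_comm]
  calc r ^ n * (n ! : ℝ) ^ b = (1 / 2) ^ n * (c ^ n / n ! : ℝ) ^ (-b) := by
        rw [hpow, mul_pow, ← mul_assoc, ← mul_assoc, ← mul_pow]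
        norm_num
    _ ≤ (1 / 2) ^ n * Real.exp c ^ (-b) := by
        gcongr
        · linarith
        · exact Real.pow_div_factorial_le_exp c hc0.le n
    _ = (1 / 2) ^ n * Real.exp (-b * c) := by rw [← Real.exp_mul, mul_comm c]

theorem Gamma_natCast_mul_add_one_le {a : ℝ} (ha : 0 < a) (ha' : a < 1) (n : ℕ) :
    Real.Gamma (n * a + 1) ≤ (n ! : ℝ) ^ a := by
  have h := Real.Gamma_mul_add_mul_le_rpow_Gamma_mul_rpow_Gamma (s := 1) (t := n + 1)
    one_pos (by positivity) (sub_pos.2 ha') ha (by ring)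
  rwa [Real.Gamma_one, Real.one_rpow, one_mul, Real.Gamma_nat_eq_factorial,
    show (1 - a) * 1 + a * (n + 1) = n * a + 1 by ring] at h

theorem Gamma_succ_mul_div_factorial {a : ℝ} (ha : 0 < a) (n : ℕ) :
    Real.Gamma ((n + 1) * a) / n ! = Real.Gamma ((n + 1) * a + 1) / (n + 1)! / a := by
  rw [Real.Gamma_add_one (by positivity), Nat.factorial_succ]
  push_cast
  field_simp

theorem summable_pow_mul_Gamma_div_factorial {a : ℝ} (ha : 0 < a) (ha' : a < 1) {r : ℝ}
    (hr : 0 ≤ r) : Summable fun n : ℕ => r ^ n * (Real.Gamma ((n + 1) * a) / n !) := by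
  have hΓ (n : ℕ) : 0 < Real.Gamma ((n + 1) * a) := Real.Gamma_pos_of_pos (by positivity)
  refine Summable.of_nonneg_of_le (fun n => by have := hΓ n; positivity) (fun n => ?_)
    ((summable_pow_mul_factorial_rpow (sub_neg.2 ha') hr).mul_left a⁻¹)
  have hfac : (0 : ℝ) < (n + 1)! := by positivity
  calc r ^ n * (Real.Gamma ((n + 1) * a) / n !)
      ≤ r ^ n * (((n + 1)! : ℝ) ^ a / (n + 1)! / a) := by
        rw [Gamma_succ_mul_div_factorial ha]
        gcongr
        exact_mod_cast Gamma_natCast_mul_add_one_le ha ha' (n + 1)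
    _ ≤ r ^ n * ((n ! : ℝ) ^ (a - 1) / a) := by
        rw [← Real.rpow_sub_one hfac.ne']
        gcongr ?_ * (?_ / a)
        exact Real.rpow_le_rpow_of_nonpos (by positivity)
          (by exact_mod_cast Nat.factorial_le n.le_succ) (by linarith)
    _ = a⁻¹ * (r ^ n * (n ! : ℝ) ^ (a - 1)) := by ring

theorem integrableOn_rpow_mul_exp {s c : ℝ} (hs : 0 < s) (hc : c < 0) :
    IntegrableOn (fun t : ℝ => t ^ (s - 1) * Real.exp (c * t)) (Set.Ioi 0) := by
  simpa using integrableOn_rpow_mul_exp_neg_mul_rpow (p := 1) (s := s - 1) (b := -c)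
    (by linarith) one_pos (by linarith)

theorem eqOn_of_eventually_ofReal_eq {E : Type*} [NormedAddCommGroup E] [NormedSpace ℂ E]
    {f g : ℂ → E} {V : Set ℂ} (hf : AnalyticOnNhd ℂ f V) (hg : AnalyticOnNhd ℂ g V)
    (hV : IsPreconnected V) {x : ℝ} (hx : (x : ℂ) ∈ V) (h : ∀ᶠ c : ℝ in 𝓝 x, f c = g c) :
    Set.EqOn f g V := by
  have htendsto : Tendsto ((↑) : ℝ → ℂ) (𝓝[≠] x) (𝓝[≠] (x : ℂ)) :=
    Complex.continuous_ofReal.continuousWithinAt.tendsto_nhdsWithin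
      fun c hc => Complex.ofReal_injective.ne hc
  exact hf.eqOn_of_preconnected_of_frequently_eq hg hV hx
    (htendsto.frequently (h.filter_mono nhdsWithin_le_nhds).frequently)

/-- By the identity theorem, as both sides are analytic in `z`: the left side is a complex moment
generating function. -/
theorem integral_rpow_mul_cexp {s : ℝ} (hs : 0 < s) {z : ℂ} (hz : z.re < 0) :
    ∫ t in Set.Ioi (0 : ℝ), ((t ^ (s - 1) : ℝ) : ℂ) * Complex.exp (z * t) =
      Real.Gamma s * (-z) ^ (-(s : ℂ)) := by
  set μ := (volume.restrict (Set.Ioi (0 : ℝ))).withDensity fun t => ENNReal.ofReal (t ^ (s - 1))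
  have hmeas : Measurable fun t : ℝ => ENNReal.ofReal (t ^ (s - 1)) := by fun_prop
  have htoReal {t : ℝ} (ht : t ∈ Set.Ioi 0) :
      (ENNReal.ofReal (t ^ (s - 1))).toReal = t ^ (s - 1) :=
    ENNReal.toReal_ofReal (Real.rpow_nonneg (le_of_lt ht) _)
  have hmgf (z : ℂ) : ProbabilityTheory.complexMGF id μ z =
      ∫ t in Set.Ioi (0 : ℝ), ((t ^ (s - 1) : ℝ) : ℂ) * Complex.exp (z * t) := by
    rw [ProbabilityTheory.complexMGF, integral_withDensity_eq_integral_toReal_smul hmeas (by simp)]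
    refine setIntegral_congr_fun measurableSet_Ioi fun t ht => ?_
    simp only [htoReal ht, Complex.real_smul, id]
  have hset : Set.Iio 0 ⊆ ProbabilityTheory.integrableExpSet id μ := fun c hc => by
    refine (integrable_withDensity_iff_integrable_smul' hmeas (by simp)).2 ?_
    refine IntegrableOn.congr_fun (integrableOn_rpow_mul_exp hs hc) (fun t ht => ?_)
      measurableSet_Ioi
    simp only [htoReal ht, smul_eq_mul, id]
  have hleft : AnalyticOnNhd ℂ (ProbabilityTheory.complexMGF id μ) {z | z.re < 0} :=
    ProbabilityTheory.analyticOnNhd_complexMGF.mono fun z hz =>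
      interior_maximal hset isOpen_Iio hz
  have hright : AnalyticOnNhd ℂ (fun z : ℂ => Real.Gamma s * (-z) ^ (-(s : ℂ))) {z | z.re < 0} :=
    fun z hz => analyticAt_const.mul
      (analyticAt_id.neg.cpow analyticAt_const (Or.inl (by simpa using hz)))
  have hreal {c : ℝ} (hc : c < 0) :
      ProbabilityTheory.complexMGF id μ c = Real.Gamma s * (-(c : ℂ)) ^ (-(s : ℂ)) := by
    have h := Real.integral_rpow_mul_exp_neg_mul_Ioi hs (neg_pos.2 hc)
    rw [hmgf, ← Complex.ofReal_neg, ← Complex.ofReal_neg, ← Complex.ofReal_cpow (by linarith),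
      ← Complex.ofReal_mul, Real.rpow_neg (by linarith), ← Real.inv_rpow (by linarith),
      ← one_div, mul_comm (Real.Gamma s), ← h, ← integral_complex_ofReal]
    simp
  rw [← hmgf]
  exact eqOn_of_eventually_ofReal_eq hleft hright (convex_halfSpace_re_lt 0).isPreconnected
    (x := -1) (by simp) (eventually_of_mem (Iio_mem_nhds neg_one_lt_zero) fun c hc => hreal hc) hz

/-- The point at distance `ρ` from `R` on the ray from `R` in the direction `e ^ {iθ}`. -/
def rayPoint (θ R ρ : ℝ) : ℂ := R + ρ * Complex.exp (θ * I)

/-- The integral of `f` along the ray from `R` to infinity in the direction `e ^ {iθ}`. -/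
def rayIntegral (f : ℂ → ℂ) (θ R : ℝ) : ℂ :=
  ∫ ρ in Set.Ioi (0 : ℝ), f (rayPoint θ R ρ) * Complex.exp (θ * I)

section Ray

variable {θ R ρ s : ℝ}

theorem rayPoint_re : (rayPoint θ R ρ).re = R + ρ * Real.cos θ := by
  simp [rayPoint, Complex.exp_re]

theorem rayPoint_im : (rayPoint θ R ρ).im = ρ * Real.sin θ := by
  simp [rayPoint, Complex.exp_im]

theorem rayPoint_zero_right : rayPoint θ R 0 = R := by
  simp [rayPoint]

theorem hasDerivAt_rayPoint_left : HasDerivAt (fun r => rayPoint θ r ρ) 1 R :=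
  (hasDerivAt_id R).ofReal_comp.add_const _

theorem hasDerivAt_rayPoint_right :
    HasDerivAt (rayPoint θ R) (Complex.exp (θ * I)) ρ :=
  (((hasDerivAt_id ρ).ofReal_comp.mul_const _).const_add (R : ℂ)).congr_deriv (by simp)

theorem continuous_rayPoint : Continuous (rayPoint θ R) := by
  unfold rayPoint; fun_prop

theorem mul_sin_le_norm_rayPoint_left : R * Real.sin θ ≤ ‖rayPoint θ R ρ‖ := by
  have h : ((-rayPoint θ R ρ) * Complex.exp ((-θ : ℝ) * I)).im = R * Real.sin θ := by
    rw [Complex.mul_im, Complex.neg_re, Complex.neg_im, rayPoint_re, rayPoint_im,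
      Complex.exp_ofReal_mul_I_re, Complex.exp_ofReal_mul_I_im, Real.cos_neg, Real.sin_neg]
    ring
  calc R * Real.sin θ ≤ ‖(-rayPoint θ R ρ) * Complex.exp ((-θ : ℝ) * I)‖ :=
        h ▸ (le_abs_self _).trans (Complex.abs_im_le_norm _)
    _ = ‖rayPoint θ R ρ‖ := by rw [norm_mul, norm_neg, Complex.norm_exp_ofReal_mul_I, mul_one]

theorem mul_sin_le_norm_rayPoint_right : ρ * Real.sin θ ≤ ‖rayPoint θ R ρ‖ :=
  rayPoint_im (R := R) ▸ (le_abs_self _).trans (Complex.abs_im_le_norm _)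

theorem rayPoint_mem_slitPlane (hθ : 0 < Real.sin θ) (hρ : 0 ≤ ρ) (h : 0 < R ∨ 0 < ρ) :
    rayPoint θ R ρ ∈ Complex.slitPlane := by
  rw [Complex.mem_slitPlane_iff, rayPoint_re, rayPoint_im]
  rcases hρ.eq_or_lt with rfl | hρ'
  · left; simpa using h
  · right; positivity

theorem arg_rayPoint_mem (hθ : 0 < θ) (hθ' : θ < π) (hR : 0 ≤ R) (hρ : 0 ≤ ρ) :
    (rayPoint θ R ρ).arg ∈ Set.Icc 0 θ := by
  have hsin : 0 < Real.sin θ := Real.sin_pos_of_pos_of_lt_pi hθ hθ'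
  refine ⟨Complex.arg_nonneg_iff.2 (rayPoint_im.symm ▸ by positivity), ?_⟩
  by_contra! hlt
  have hne : rayPoint θ R ρ ≠ 0 := fun h => by
    rw [h, Complex.arg_zero] at hlt
    exact hlt.not_gt hθ
  have hrot : ‖rayPoint θ R ρ‖ * Real.sin ((rayPoint θ R ρ).arg - θ) = -(R * Real.sin θ) := by
    rw [Real.sin_sub, mul_sub, ← mul_assoc, ← mul_assoc, Complex.norm_mul_sin_arg,
      Complex.norm_mul_cos_arg, rayPoint_re, rayPoint_im]
    ring
  have : 0 < ‖rayPoint θ R ρ‖ * Real.sin ((rayPoint θ R ρ).arg - θ) :=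
    mul_pos (norm_pos_iff.2 hne) (Real.sin_pos_of_pos_of_lt_pi (by linarith)
      (by linarith [Complex.arg_le_pi (rayPoint θ R ρ)]))
  linarith [mul_nonneg hR hsin.le]

theorem rayPoint_zero_cpow (hθ : 0 < θ) (hθ' : θ < π) (hρ : 0 < ρ) :
    rayPoint θ 0 ρ ^ (s : ℂ) = (ρ ^ s : ℝ) * Complex.exp (θ * s * I) := by
  rw [rayPoint, Complex.ofReal_zero, zero_add, Complex.cpow_def_of_ne_zero (by simp [hρ.ne']),
    Complex.log_ofReal_mul hρ (Complex.exp_ne_zero _),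
    Complex.log_exp (by simp; linarith) (by simp; linarith), add_mul, Complex.exp_add,
    Complex.ofReal_cpow hρ.le, Complex.cpow_def_of_ne_zero (by simp [hρ.ne']),
    Complex.ofReal_log hρ.le]
  ring_nf

theorem hasDerivAt_rayIntegral {f : ℂ → ℂ} {V : Set ℝ} {bound : ℝ → ℝ} (hV : V ∈ 𝓝 R)
    (hf : ∀ r ∈ V, ∀ ρ, 0 ≤ ρ → DifferentiableAt ℂ f (rayPoint θ r ρ))
    (hfint : IntegrableOn (fun ρ => f (rayPoint θ R ρ)) (Set.Ioi 0))
    (hf' : ∀ r ∈ V, ∀ ρ, 0 < ρ → ‖deriv f (rayPoint θ r ρ)‖ ≤ bound ρ)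
    (hbound : IntegrableOn bound (Set.Ioi 0)) :
    HasDerivAt (rayIntegral f θ) (-f R) R := by
  have hmeas (r : ℝ) (hr : r ∈ V) : AEStronglyMeasurable
      (fun ρ => f (rayPoint θ r ρ) * Complex.exp (θ * I)) (volume.restrict (Set.Ioi 0)) :=
    ContinuousOn.aestronglyMeasurable (fun ρ hρ => (((hf r hr ρ (le_of_lt hρ)).continuousAt.comp
      continuous_rayPoint.continuousAt).mul continuousAt_const).continuousWithinAt)
      measurableSet_Ioi
  have hdiff (ρ : ℝ) (hρ : 0 ≤ ρ) : HasDerivAt (fun ρ => f (rayPoint θ R ρ))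
      (deriv f (rayPoint θ R ρ) * Complex.exp (θ * I)) ρ :=
    (hf R (mem_of_mem_nhds hV) ρ hρ).hasDerivAt.comp ρ hasDerivAt_rayPoint_right
  obtain ⟨hint, hder⟩ := hasDerivAt_integral_of_dominated_loc_of_deriv_le
    (F := fun r ρ => f (rayPoint θ r ρ) * Complex.exp (θ * I))
    (F' := fun r ρ => deriv f (rayPoint θ r ρ) * Complex.exp (θ * I))
    hV (eventually_of_mem hV hmeas) (hfint.mul_const _)
    (((measurable_deriv f).comp continuous_rayPoint.measurable).mul_const _).aestronglyMeasurable
    (by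
      filter_upwards [ae_restrict_mem measurableSet_Ioi] with ρ hρ r hr
      simpa [Complex.norm_exp_ofReal_mul_I] using hf' r hr ρ hρ)
    hbound
    (by
      filter_upwards [ae_restrict_mem measurableSet_Ioi] with ρ hρ r hr
      simpa using ((hf r hr ρ (le_of_lt hρ)).hasDerivAt.comp r
        hasDerivAt_rayPoint_left).mul_const (Complex.exp (θ * I)))
  have hlim := tendsto_zero_of_hasDerivAt_of_integrableOn_Ioi (fun ρ hρ => hdiff ρ (le_of_lt hρ))
    hint hfint
  have hftc := integral_Ioi_of_hasDerivAt_of_tendsto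
    (hdiff 0 le_rfl).continuousAt.continuousWithinAt (fun ρ hρ => hdiff ρ (le_of_lt hρ)) hint hlim
  rwa [hftc, rayPoint_zero_right, zero_sub] at hder

theorem norm_rayPoint_zero_cpow_mul_exp (hθ : 0 < θ) (hθ' : θ < π) (hρ : 0 < ρ) :
    ‖rayPoint θ 0 ρ ^ (s : ℂ) * Complex.exp (rayPoint θ 0 ρ)‖ =
      ρ ^ s * Real.exp (Real.cos θ * ρ) := by
  have : 0 < ρ ^ s := Real.rpow_pos_of_pos hρ s
  rw [norm_mul, Complex.norm_exp, rayPoint_re, rayPoint_zero_cpow hθ hθ' hρ, norm_mul,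
    ← Complex.ofReal_mul, Complex.norm_exp_ofReal_mul_I, Complex.norm_real,
    Real.norm_of_nonneg this.le, mul_one, zero_add, mul_comm ρ]

theorem integrableOn_rayPoint_zero_cpow_mul_exp (hs : 0 < s) (hθ : π / 2 < θ) (hθ' : θ < π) :
    IntegrableOn (fun ρ => rayPoint θ 0 ρ ^ ((s - 1 : ℝ) : ℂ) * Complex.exp (rayPoint θ 0 ρ))
      (Set.Ioi 0) := by
  have hmeas := (continuous_rayPoint (θ := θ) (R := 0)).measurable
  have hint := integrableOn_rpow_mul_exp hs
    (Real.cos_neg_of_pi_div_two_lt_of_lt hθ (by linarith [Real.pi_pos]))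
  refine (integrable_norm_iff (Measurable.aestronglyMeasurable (by fun_prop))).1
    (IntegrableOn.congr_fun hint (fun ρ hρ => ?_) measurableSet_Ioi)
  exact (norm_rayPoint_zero_cpow_mul_exp (by linarith [Real.pi_pos]) hθ' hρ).symm

theorem integral_norm_rayPoint_zero_cpow_mul_exp (hs : 0 < s) (hθ : π / 2 < θ) (hθ' : θ < π) :
    ∫ ρ in Set.Ioi 0, ‖rayPoint θ 0 ρ ^ ((s - 1 : ℝ) : ℂ) * Complex.exp (rayPoint θ 0 ρ)‖ =
      (1 / -Real.cos θ) ^ s * Real.Gamma s := by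
  rw [← Real.integral_rpow_mul_exp_neg_mul_Ioi hs
    (neg_pos.2 (Real.cos_neg_of_pi_div_two_lt_of_lt hθ (by linarith [Real.pi_pos])))]
  refine setIntegral_congr_fun measurableSet_Ioi fun ρ hρ => ?_
  simp only [norm_rayPoint_zero_cpow_mul_exp (by linarith [Real.pi_pos]) hθ' hρ, neg_mul, neg_neg]

theorem rayIntegral_cpow_mul_exp (hs : 0 < s) (hθ : π / 2 < θ) (hθ' : θ < π) :
    rayIntegral (fun σ => σ ^ ((s - 1 : ℝ) : ℂ) * Complex.exp σ) θ 0 =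
      Real.Gamma s * Complex.exp ((π * s : ℝ) * I) := by
  have hθ0 : 0 < θ := by linarith [Real.pi_pos]
  have hcos : (Complex.exp (θ * I)).re < 0 := by
    rw [Complex.exp_ofReal_mul_I_re]
    exact Real.cos_neg_of_pi_div_two_lt_of_lt hθ (by linarith)
  have hneg : -Complex.exp (θ * I) = Complex.exp ((θ - π : ℝ) * I) := by
    push_cast
    rw [sub_mul, Complex.exp_sub, Complex.exp_pi_mul_I, div_neg, div_one]
  have hcpow : Complex.exp ((θ - π : ℝ) * I) ^ (-(s : ℂ)) =
      Complex.exp (-((θ - π : ℝ) * I * s)) := by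
    rw [Complex.cpow_def_of_ne_zero (Complex.exp_ne_zero _), Complex.log_exp (by simp; linarith)
      (by simp; linarith), mul_neg]
  calc rayIntegral (fun σ => σ ^ ((s - 1 : ℝ) : ℂ) * Complex.exp σ) θ 0
      = ∫ ρ in Set.Ioi (0 : ℝ), Complex.exp (θ * s * I) *
          (((ρ ^ (s - 1) : ℝ) : ℂ) * Complex.exp (Complex.exp (θ * I) * ρ)) := by
        refine setIntegral_congr_fun measurableSet_Ioi fun ρ hρ => ?_
        simp only [rayPoint_zero_cpow hθ0 hθ' hρ]
        rw [show (θ * s * I : ℂ) = θ * (s - 1 : ℝ) * I + θ * I by push_cast; ring, Complex.exp_add,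
          rayPoint, Complex.ofReal_zero, zero_add, mul_comm (ρ : ℂ)]
        ring
    _ = Real.Gamma s * Complex.exp ((π * s : ℝ) * I) := by
        rw [integral_const_mul, integral_rpow_mul_cexp hs hcos, hneg, hcpow, mul_left_comm,
          ← Complex.exp_add]
        push_cast
        ring_nf

end Ray

/-- The angles `θ` such that both `e ^ σ` and `e ^ {-x σ ^ a}`, `x > 0`, decay along the rays in
the direction `e ^ {iθ}`. -/
structure IsDecayAngle (a θ : ℝ) : Prop where
  pi_div_two_lt : π / 2 < θ
  lt_pi : θ < π
  mul_lt : a * θ < π / 2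

theorem exists_isDecayAngle {a : ℝ} (ha : 0 < a) (ha' : a < 1) : ∃ θ, IsDecayAngle a θ := by
  have hpi := Real.pi_pos
  obtain ⟨θ, hθ, hθ'⟩ := exists_between
    (lt_min (by linarith : π / 2 < π) ((lt_div_iff₀ ha).2 (by nlinarith) : π / 2 < π / 2 / a))
  exact ⟨θ, hθ, hθ'.trans_le (min_le_left _ _),
    (lt_div_iff₀' ha).1 (hθ'.trans_le (min_le_right _ _))⟩

namespace IsDecayAngle

variable {a θ : ℝ}

theorem pos (h : IsDecayAngle a θ) : 0 < θ := by linarith [Real.pi_pos, h.pi_div_two_lt]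

theorem sin_pos (h : IsDecayAngle a θ) : 0 < Real.sin θ :=
  Real.sin_pos_of_pos_of_lt_pi h.pos h.lt_pi

theorem cos_neg (h : IsDecayAngle a θ) : Real.cos θ < 0 :=
  Real.cos_neg_of_pi_div_two_lt_of_lt h.pi_div_two_lt (by linarith [Real.pi_pos, h.lt_pi])

theorem cos_mul_pos (h : IsDecayAngle a θ) (ha : 0 < a) : 0 < Real.cos (a * θ) :=
  Real.cos_pos_of_mem_Ioo ⟨by linarith [Real.pi_pos, mul_pos ha h.pos], h.mul_lt⟩

end IsDecayAngle

/-- The integrand `σ ^ (a - 1) e ^ {σ - x σ ^ a}` of the Hankel contour integral representing the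
density `subordDensity a x`. -/
def wrightIntegrand (a x : ℝ) (σ : ℂ) : ℂ :=
  σ ^ ((a - 1 : ℝ) : ℂ) * Complex.exp (σ - x * σ ^ (a : ℂ))

section WrightIntegrand

variable {a θ x R ρ δ : ℝ} {z : ℂ}

theorem wrightIntegrand_ofReal_im (hR : 0 ≤ R) : (wrightIntegrand a x R).im = 0 := by
  rw [wrightIntegrand, ← Complex.ofReal_cpow hR, ← Complex.ofReal_cpow hR, ← Complex.ofReal_mul,
    ← Complex.ofReal_sub, ← Complex.ofReal_exp, ← Complex.ofReal_mul, Complex.ofReal_im]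

theorem hasDerivAt_wrightIntegrand (hz : z ∈ Complex.slitPlane) :
    HasDerivAt (wrightIntegrand a x)
      (wrightIntegrand a x z * ((a - 1) / z + 1 - x * (a * z ^ ((a - 1 : ℝ) : ℂ)))) z := by
  have hpow := (hasDerivAt_id z).cpow_const (c := ((a - 1 : ℝ) : ℂ)) hz
  have hexp := ((hasDerivAt_id z).sub
    (((hasDerivAt_id z).cpow_const (c := (a : ℂ)) hz).const_mul (x : ℂ))).cexp
  refine (hpow.mul hexp).congr_deriv ?_
  simp only [id, mul_one, wrightIntegrand, Pi.sub_apply]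
  rw [Complex.cpow_sub _ 1 (Complex.slitPlane_ne_zero hz), Complex.cpow_one]
  push_cast
  ring

theorem norm_wrightIntegrand :
    ‖wrightIntegrand a x z‖ = ‖z‖ ^ (a - 1) * Real.exp (z.re - x * (z ^ (a : ℂ)).re) := by
  rw [wrightIntegrand, norm_mul, Complex.norm_exp, Complex.norm_cpow_real, Complex.sub_re,
    Complex.re_ofReal_mul]

theorem cos_mul_norm_rpow_le_re_cpow (ha : 0 ≤ a) (ha' : a * θ ≤ π)
    (hz : z.arg ∈ Set.Icc 0 θ) : Real.cos (a * θ) * ‖z‖ ^ a ≤ (z ^ (a : ℂ)).re := by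
  rw [Complex.cpow_ofReal_re, mul_comm, mul_comm z.arg]
  gcongr
  exact Real.cos_le_cos_of_nonneg_of_le_pi (mul_nonneg ha hz.1) ha'
    (mul_le_mul_of_nonneg_left hz.2 ha)

theorem norm_wrightIntegrand_rayPoint_le (ha : 0 < a) (ha' : a < 1) (hθ : IsDecayAngle a θ)
    (hx : 0 ≤ x) (hR : 0 ≤ R) (hρ : 0 ≤ ρ) (hδ : 0 < δ) (hδρ : δ ≤ ‖rayPoint θ R ρ‖) :
    ‖wrightIntegrand a x (rayPoint θ R ρ)‖ ≤
      δ ^ (a - 1) * Real.exp (R - x * (Real.cos (a * θ) * δ ^ a)) *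
        Real.exp (Real.cos θ * ρ) := by
  have hcos := hθ.cos_mul_pos ha
  have hre := cos_mul_norm_rpow_le_re_cpow ha.le (by linarith [hθ.mul_lt, Real.pi_pos])
    (arg_rayPoint_mem hθ.pos hθ.lt_pi hR hρ)
  rw [norm_wrightIntegrand, rayPoint_re, mul_assoc,
    ← Real.exp_add, sub_add_eq_add_sub, mul_comm (Real.cos θ)]
  gcongr ?_ * Real.exp (_ - x * ?_)
  · exact Real.rpow_le_rpow_of_nonpos hδ hδρ (by linarith)
  · exact le_trans (by gcongr) hre

theorem norm_deriv_wrightIntegrand_le (ha : 0 < a) (ha' : a < 1) (hx : 0 ≤ x)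
    (hz : z ∈ Complex.slitPlane) (hδ : 0 < δ) (hδz : δ ≤ ‖z‖) :
    ‖deriv (wrightIntegrand a x) z‖ ≤
      ‖wrightIntegrand a x z‖ * ((1 - a) / δ + 1 + x * (a * δ ^ (a - 1))) := by
  have hpow : ‖z‖ ^ (a - 1) ≤ δ ^ (a - 1) := Real.rpow_le_rpow_of_nonpos hδ hδz (by linarith)
  have hdiv : ‖((a - 1) / z : ℂ)‖ ≤ (1 - a) / δ := by
    rw [norm_div, ← Complex.ofReal_one, ← Complex.ofReal_sub, Complex.norm_real, Real.norm_eq_abs,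
      abs_of_neg (by linarith), neg_sub]
    gcongr
  rw [(hasDerivAt_wrightIntegrand hz).deriv, norm_mul]
  gcongr
  refine (norm_sub_le _ _).trans (add_le_add ((norm_add_le _ _).trans ?_) ?_)
  · simpa using hdiv
  · rw [norm_mul, norm_mul, Complex.norm_cpow_real, Complex.norm_real, Complex.norm_real,
      Real.norm_of_nonneg hx, Real.norm_of_nonneg ha.le]
    gcongr

theorem continuousOn_wrightIntegrand_rayPoint (hθ : IsDecayAngle a θ) (R : ℝ) :
    ContinuousOn (fun ρ => wrightIntegrand a x (rayPoint θ R ρ)) (Set.Ioi 0) := fun _ hρ =>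
  ((hasDerivAt_wrightIntegrand (rayPoint_mem_slitPlane hθ.sin_pos (le_of_lt hρ)
    (Or.inr hρ))).continuousAt.comp continuous_rayPoint.continuousAt).continuousWithinAt

theorem integrableOn_wrightIntegrand_rayPoint (ha : 0 < a) (ha' : a < 1) (hθ : IsDecayAngle a θ)
    (hx : 0 ≤ x) (hR : 0 < R) :
    IntegrableOn (fun ρ => wrightIntegrand a x (rayPoint θ R ρ)) (Set.Ioi 0) := by
  refine Integrable.mono' ((integrableOn_exp_mul_Ioi hθ.cos_neg 0).const_mul
      ((R * Real.sin θ) ^ (a - 1) * Real.exp (R - x * (Real.cos (a * θ) * (R * Real.sin θ) ^ a))))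
    ((continuousOn_wrightIntegrand_rayPoint hθ R).aestronglyMeasurable measurableSet_Ioi) ?_
  filter_upwards [ae_restrict_mem measurableSet_Ioi] with ρ hρ
  exact norm_wrightIntegrand_rayPoint_le ha ha' hθ hx hR.le (le_of_lt hρ)
    (mul_pos hR hθ.sin_pos) mul_sin_le_norm_rayPoint_left

theorem hasDerivAt_rayIntegral_wrightIntegrand (ha : 0 < a) (ha' : a < 1) (hθ : IsDecayAngle a θ)
    (hx : 0 ≤ x) (hR : 0 < R) :
    HasDerivAt (rayIntegral (wrightIntegrand a x) θ) (-wrightIntegrand a x R) R := by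
  have hsin := hθ.sin_pos
  have hcos := hθ.cos_mul_pos ha
  set δ := R / 2 * Real.sin θ with hδ
  have hδ0 : 0 < δ := by positivity
  have hmem {r ρ : ℝ} (hr : r ∈ Set.Ioo (R / 2) (2 * R)) (hρ : 0 ≤ ρ) :
      rayPoint θ r ρ ∈ Complex.slitPlane :=
    rayPoint_mem_slitPlane hsin hρ (Or.inl (by linarith [hr.1]))
  have hnorm {r ρ : ℝ} (hr : r ∈ Set.Ioo (R / 2) (2 * R)) : δ ≤ ‖rayPoint θ r ρ‖ :=
    le_trans (by rw [hδ]; gcongr; exact hr.1.le) mul_sin_le_norm_rayPoint_left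
  refine hasDerivAt_rayIntegral (Ioo_mem_nhds (by linarith : R / 2 < R) (by linarith : R < 2 * R))
    (fun r hr ρ hρ => (hasDerivAt_wrightIntegrand (hmem hr hρ)).differentiableAt)
    (integrableOn_wrightIntegrand_rayPoint ha ha' hθ hx hR) (fun r hr ρ hρ => ?_)
    (((integrableOn_exp_mul_Ioi hθ.cos_neg 0).const_mul (δ ^ (a - 1) * Real.exp (2 * R))).mul_const
      ((1 - a) / δ + 1 + x * (a * δ ^ (a - 1))))
  have : 0 < 1 - a := by linarith
  refine (norm_deriv_wrightIntegrand_le ha ha' hx (hmem hr hρ.le) hδ0 (hnorm hr)).trans ?_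
  gcongr
  refine (norm_wrightIntegrand_rayPoint_le ha ha' hθ hx (by linarith [hr.1]) hρ.le hδ0
    (hnorm hr)).trans ?_
  gcongr
  have : 0 ≤ x * (Real.cos (a * θ) * δ ^ a) := by positivity
  linarith [hr.2]

theorem tendsto_rayIntegral_wrightIntegrand_zero (ha : 0 < a) (ha' : a < 1)
    (hθ : IsDecayAngle a θ) (hx : 0 ≤ x) :
    Tendsto (rayIntegral (wrightIntegrand a x) θ) (𝓝[>] 0)
      (𝓝 (rayIntegral (wrightIntegrand a x) θ 0)) := by
  have hsin := hθ.sin_pos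
  have hcos := hθ.cos_mul_pos ha
  refine continuousWithinAt_of_dominated (bound := fun ρ => Real.sin θ ^ (a - 1) * Real.exp 1 *
    (ρ ^ (a - 1) * Real.exp (Real.cos θ * ρ))) (Eventually.of_forall fun R =>
      ((continuousOn_wrightIntegrand_rayPoint hθ R).aestronglyMeasurable
        measurableSet_Ioi).mul_const _) ?_
    ((integrableOn_rpow_mul_exp ha hθ.cos_neg).const_mul _) ?_
  · filter_upwards [Ioo_mem_nhdsGT (zero_lt_one (α := ℝ))] with R hR
    filter_upwards [ae_restrict_mem measurableSet_Ioi] with ρ hρ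
    have hρ : 0 < ρ := hρ
    rw [norm_mul, Complex.norm_exp_ofReal_mul_I, mul_one]
    refine (norm_wrightIntegrand_rayPoint_le ha ha' hθ hx hR.1.le hρ.le (mul_pos hρ hsin)
      mul_sin_le_norm_rayPoint_right).trans ?_
    have : 0 ≤ x * (Real.cos (a * θ) * (ρ * Real.sin θ) ^ a) := by positivity
    calc _ ≤ (ρ * Real.sin θ) ^ (a - 1) * Real.exp 1 * Real.exp (Real.cos θ * ρ) := by
          gcongr; linarith [hR.2]
      _ = _ := by rw [Real.mul_rpow hρ.le hsin.le]; ring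
  · filter_upwards [ae_restrict_mem measurableSet_Ioi] with ρ hρ
    have hcont := ContinuousAt.comp (f := fun r => rayPoint θ r ρ) (x := 0)
      (hasDerivAt_wrightIntegrand (a := a) (x := x) (rayPoint_mem_slitPlane hsin (le_of_lt hρ)
        (Or.inr hρ))).continuousAt hasDerivAt_rayPoint_left.continuousAt
    exact (hcont.mul continuousAt_const).continuousWithinAt

theorem rayIntegral_wrightIntegrand_im (ha : 0 < a) (ha' : a < 1) (hθ : IsDecayAngle a θ)
    (hx : 0 ≤ x) (hR : 0 < R) :
    (rayIntegral (wrightIntegrand a x) θ R).im = (rayIntegral (wrightIntegrand a x) θ 0).im := by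
  have hder (r : ℝ) (hr : 0 < r) :
      HasDerivAt (fun r => (rayIntegral (wrightIntegrand a x) θ r).im) 0 r :=
    (Complex.imCLM.hasFDerivAt.comp_hasDerivAt r
      (hasDerivAt_rayIntegral_wrightIntegrand ha ha' hθ hx hr)).congr_deriv
      (by simp [wrightIntegrand_ofReal_im hr.le])
  have hconst (r : ℝ) (hr : r ∈ Set.Ioi 0) : (rayIntegral (wrightIntegrand a x) θ R).im =
      (rayIntegral (wrightIntegrand a x) θ r).im :=
    isOpen_Ioi.is_const_of_deriv_eq_zero (𝕜 := ℝ) isPreconnected_Ioi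
      (fun t ht => (hder t ht).differentiableAt.differentiableWithinAt)
      (fun t ht => (hder t ht).deriv) hR hr
  exact tendsto_nhds_unique
    (tendsto_const_nhds.congr' (eventually_of_mem self_mem_nhdsWithin hconst))
    ((Complex.continuous_im.tendsto _).comp
      (tendsto_rayIntegral_wrightIntegrand_zero ha ha' hθ hx))

end WrightIntegrand

section SubordDensity

variable {a θ x R ξ : ℝ} {z : ℂ}

theorem hasSum_wrightIntegrand (hz : z ≠ 0) :
    HasSum (fun n : ℕ => (((-x) ^ n / n ! : ℝ) : ℂ) *
      (z ^ (((n + 1) * a - 1 : ℝ) : ℂ) * Complex.exp z)) (wrightIntegrand a x z) := by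
  have hexp := NormedSpace.expSeries_div_hasSum_exp (-(x * z ^ (a : ℂ)) : ℂ)
  rw [← Complex.exp_eq_exp_ℂ] at hexp
  have hval : wrightIntegrand a x z =
      z ^ ((a - 1 : ℝ) : ℂ) * Complex.exp z * Complex.exp (-(x * z ^ (a : ℂ))) := by
    rw [wrightIntegrand, sub_eq_add_neg z, Complex.exp_add, mul_assoc]
  rw [hval]
  refine (hexp.mul_left (z ^ ((a - 1 : ℝ) : ℂ) * Complex.exp z)).congr_fun fun n => ?_
  have hpow : z ^ (((n + 1) * a - 1 : ℝ) : ℂ) = z ^ ((a - 1 : ℝ) : ℂ) * (z ^ (a : ℂ)) ^ n := by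
    rw [← Complex.cpow_mul_nat, ← Complex.cpow_add _ _ hz]
    push_cast
    ring_nf
  rw [hpow, neg_mul_eq_neg_mul, mul_pow]
  push_cast
  ring

theorem hasSum_rayIntegral_wrightIntegrand_zero (ha : 0 < a) (ha' : a < 1) (hθ : π / 2 < θ)
    (hθ' : θ < π) (hx : 0 ≤ x) :
    HasSum (fun n : ℕ => (((-x) ^ n / n ! : ℝ) : ℂ) *
      (Real.Gamma ((n + 1) * a) * Complex.exp ((π * ((n + 1) * a) : ℝ) * I)))
      (rayIntegral (wrightIntegrand a x) θ 0) := by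
  have hs (n : ℕ) : 0 < (n + 1) * a := by positivity
  set F : ℕ → ℝ → ℂ := fun n ρ => (((-x) ^ n / n ! : ℝ) : ℂ) *
    (rayPoint θ 0 ρ ^ (((n + 1) * a - 1 : ℝ) : ℂ) * Complex.exp (rayPoint θ 0 ρ)) *
      Complex.exp (θ * I) with hF
  have hint (n : ℕ) : IntegrableOn (F n) (Set.Ioi 0) :=
    ((integrableOn_rayPoint_zero_cpow_mul_exp (hs n) hθ hθ').const_mul _).mul_const _
  have hsum : Summable fun n => ∫ ρ in Set.Ioi (0 : ℝ), ‖F n ρ‖ := by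
    have hb : 0 < 1 / -Real.cos θ := one_div_pos.2 (neg_pos.2
      (Real.cos_neg_of_pi_div_two_lt_of_lt hθ (by linarith [Real.pi_pos])))
    refine ((summable_pow_mul_Gamma_div_factorial ha ha'
      (r := x * (1 / -Real.cos θ) ^ a) (by positivity)).mul_left ((1 / -Real.cos θ) ^ a)).congr
        fun n => ?_
    simp only [hF, norm_mul _ (Complex.exp (θ * I)), Complex.norm_exp_ofReal_mul_I, mul_one,
      norm_mul ((_ : ℝ) : ℂ), Complex.norm_real, norm_div, norm_pow, norm_neg,
      Real.norm_of_nonneg hx, RCLike.norm_natCast, integral_const_mul,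
      integral_norm_rayPoint_zero_cpow_mul_exp (hs n) hθ hθ']
    rw [add_mul, one_mul, Real.rpow_add hb, mul_comm (n : ℝ) a, Real.rpow_mul hb.le,
      Real.rpow_natCast, mul_pow]
    ring
  have hval : ∫ ρ in Set.Ioi (0 : ℝ), ∑' n, F n ρ = rayIntegral (wrightIntegrand a x) θ 0 :=
    setIntegral_congr_fun measurableSet_Ioi fun ρ hρ => by
      have hne : rayPoint θ 0 ρ ≠ 0 := by simpa [rayPoint] using (ne_of_gt hρ : ρ ≠ 0)
      exact ((hasSum_wrightIntegrand hne).mul_right (Complex.exp (θ * I))).tsum_eq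
  have h := hasSum_integral_of_summable_integral_norm hint hsum
  rw [hval] at h
  refine h.congr_fun fun n => ?_
  rw [← rayIntegral_cpow_mul_exp (hs n) hθ hθ', rayIntegral, ← integral_const_mul]
  simp only [hF, mul_assoc]

theorem subordDensity_eq_tsum (ha : 0 < a) (hξ : 0 < ξ) :
    subordDensity a ξ = (1 / π) * ∑' n : ℕ, (-ξ) ^ n / n ! *
      (Real.Gamma ((n + 1) * a) * Real.sin (π * ((n + 1) * a))) := by
  rw [subordDensity, stableDensity, mul_left_comm, ← tsum_mul_left]
  congr 1
  refine tsum_congr fun n => ?_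
  have hpow : ξ ^ (-1 - 1 / a) * (ξ ^ (-(1 / a))) ^ (-((n + 1 : ℝ) * a) - 1) = ξ ^ n := by
    rw [← Real.rpow_mul hξ.le, ← Real.rpow_add hξ, ← Real.rpow_natCast]
    congr 1
    field_simp
    ring
  calc _ = (-1) ^ n * (ξ ^ (-1 - 1 / a) * (ξ ^ (-(1 / a))) ^ (-((n + 1 : ℝ) * a) - 1)) *
        (Real.Gamma ((n + 1) * a + 1) / (n + 1)! / a) * Real.sin ((n + 1) * π * a) := by ring
    _ = _ := by
      rw [hpow, ← Gamma_succ_mul_div_factorial ha, neg_pow ξ n]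
      ring_nf

theorem subordDensity_eq_rayIntegral_zero (ha : 0 < a) (ha' : a < 1) (hθ : π / 2 < θ)
    (hθ' : θ < π) (hξ : 0 < ξ) :
    subordDensity a ξ = (1 / π) * (rayIntegral (wrightIntegrand a ξ) θ 0).im := by
  have h := Complex.imCLM.hasSum (hasSum_rayIntegral_wrightIntegrand_zero ha ha' hθ hθ' hξ.le)
  rw [subordDensity_eq_tsum ha hξ, ← Complex.imCLM_apply, ← h.tsum_eq]
  simp only [Complex.imCLM_apply, Complex.im_ofReal_mul, Complex.exp_ofReal_mul_I_im]

theorem subordDensity_eq_rayIntegral (ha : 0 < a) (ha' : a < 1) (hθ : IsDecayAngle a θ)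
    (hξ : 0 < ξ) (hR : 0 < R) :
    subordDensity a ξ = (1 / π) * (rayIntegral (wrightIntegrand a ξ) θ R).im := by
  rw [subordDensity_eq_rayIntegral_zero ha ha' hθ.pi_div_two_lt hθ.lt_pi hξ,
    rayIntegral_wrightIntegrand_im ha ha' hθ hξ.le hR]

theorem continuousOn_subordDensity (ha : 0 < a) (ha' : a < 1) :
    ContinuousOn (subordDensity a) (Set.Ioi 0) := by
  obtain ⟨θ, hθ⟩ := exists_isDecayAngle ha ha'
  have hcos := hθ.cos_mul_pos ha
  have hsin := hθ.sin_pos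
  have hcont : ContinuousOn (fun ξ => rayIntegral (wrightIntegrand a ξ) θ 1) (Set.Ioi 0) := by
    refine continuousOn_of_dominated (bound := fun ρ => Real.sin θ ^ (a - 1) * Real.exp 1 *
      Real.exp (Real.cos θ * ρ)) (fun ξ _ =>
        ((continuousOn_wrightIntegrand_rayPoint hθ 1).aestronglyMeasurable
          measurableSet_Ioi).mul_const _) (fun ξ hξ => ?_)
      ((integrableOn_exp_mul_Ioi hθ.cos_neg 0).const_mul _) ?_
    · filter_upwards [ae_restrict_mem measurableSet_Ioi] with ρ hρ
      have hξ : 0 < ξ := hξ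
      rw [norm_mul, Complex.norm_exp_ofReal_mul_I, mul_one]
      refine (norm_wrightIntegrand_rayPoint_le ha ha' hθ hξ.le zero_le_one (le_of_lt hρ) hsin
        ((one_mul _).symm.trans_le mul_sin_le_norm_rayPoint_left)).trans ?_
      have : 0 ≤ ξ * (Real.cos (a * θ) * Real.sin θ ^ a) := by positivity
      gcongr
      linarith
    · refine ae_of_all _ fun ρ => Continuous.continuousOn ?_
      unfold wrightIntegrand
      fun_prop
  refine ((Complex.continuous_im.comp_continuousOn hcont).const_mul (1 / π)).congr fun ξ hξ => ?_
  exact subordDensity_eq_rayIntegral ha ha' hθ hξ one_pos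

/-- On the ray from `R` the contour integrand is `O(e ^ {-ξ cos(aθ) (R sin θ) ^ a})`, and `R` is
free. -/
theorem exists_abs_subordDensity_le (ha : 0 < a) (ha' : a < 1) (K : ℝ) :
    ∃ C, 0 < C ∧ ∀ ξ, 0 < ξ → |subordDensity a ξ| ≤ C * Real.exp (-K * ξ) := by
  obtain ⟨θ, hθ⟩ := exists_isDecayAngle ha ha'
  have hcos := hθ.cos_mul_pos ha
  have hsin := hθ.sin_pos
  have hlim : Tendsto (fun R => Real.cos (a * θ) * (R * Real.sin θ) ^ a) atTop atTop :=
    ((tendsto_rpow_atTop ha).comp (tendsto_id.atTop_mul_const hsin)).const_mul_atTop hcos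
  obtain ⟨R, hKR, hR⟩ := ((hlim.eventually_ge_atTop K).and (eventually_gt_atTop 0)).exists
  set D := (R * Real.sin θ) ^ (a - 1) * Real.exp R with hD
  set J := ∫ ρ in Set.Ioi (0 : ℝ), Real.exp (Real.cos θ * ρ) with hJ
  have : 0 ≤ J := integral_nonneg fun ρ => (Real.exp_pos _).le
  have hray (ξ : ℝ) (hξ : 0 < ξ) :
      ‖rayIntegral (wrightIntegrand a ξ) θ R‖ ≤ D * Real.exp (-K * ξ) * J := by
    rw [hJ, ← integral_const_mul]
    refine norm_integral_le_of_norm_le ((integrableOn_exp_mul_Ioi hθ.cos_neg 0).const_mul _) ?_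
    filter_upwards [ae_restrict_mem measurableSet_Ioi] with ρ hρ
    rw [norm_mul, Complex.norm_exp_ofReal_mul_I, mul_one]
    refine (norm_wrightIntegrand_rayPoint_le ha ha' hθ hξ.le hR.le (le_of_lt hρ)
      (mul_pos hR hsin) mul_sin_le_norm_rayPoint_left).trans ?_
    rw [hD, mul_assoc _ (Real.exp R), ← Real.exp_add]
    gcongr
    nlinarith
  refine ⟨1 / π * (D * J) + 1, by positivity, fun ξ hξ => ?_⟩
  calc |subordDensity a ξ| = 1 / π * |(rayIntegral (wrightIntegrand a ξ) θ R).im| := by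
        rw [subordDensity_eq_rayIntegral ha ha' hθ hξ hR, abs_mul, abs_of_nonneg (by positivity)]
    _ ≤ 1 / π * (D * Real.exp (-K * ξ) * J) := by
        gcongr
        exact (Complex.abs_im_le_norm _).trans (hray ξ hξ)
    _ ≤ (1 / π * (D * J) + 1) * Real.exp (-K * ξ) := by
        linarith [Real.exp_pos (-K * ξ)]

end SubordDensity

/-! ### Weighted averages of a semigroup -/

namespace IsC0Semigroup

variable {X : Type*} [NormedAddCommGroup X] [NormedSpace ℝ X] {S : ℝ → X →L[ℝ] X}

theorem tendsto_nhdsGE_zero (hS : IsC0Semigroup S) (x : X) :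
    Tendsto (fun t => S t x) (𝓝[≥] 0) (𝓝 x) := by
  rw [← Set.Ioi_insert, nhdsWithin_insert, tendsto_sup]
  refine ⟨?_, hS.tendsto_zero x⟩
  simpa [hS.map_zero] using tendsto_pure_nhds (fun t => S t x) 0

theorem exists_norm_le_near_zero [CompleteSpace X] (hS : IsC0Semigroup S) :
    ∃ δ C : ℝ, 0 < δ ∧ 1 ≤ C ∧ ∀ t, 0 ≤ t → t ≤ δ → ‖S t‖ ≤ C := by
  by_contra! hcon
  have hseq (n : ℕ) : ∃ t : ℝ, 0 ≤ t ∧ t ≤ 1 / ((n : ℝ) + 1) ∧ (n : ℝ) + 1 < ‖S t‖ :=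
    hcon (1 / ((n : ℝ) + 1)) ((n : ℝ) + 1) (by positivity) (by simp)
  choose t ht_nonneg ht_le ht_norm using hseq
  have hlim : Tendsto t atTop (𝓝[≥] 0) := tendsto_nhdsWithin_iff.2
    ⟨squeeze_zero ht_nonneg ht_le tendsto_one_div_add_atTop_nhds_zero_nat, .of_forall ht_nonneg⟩
  obtain ⟨C, hC⟩ := banach_steinhaus (g := fun n => S (t n)) fun x => by
    obtain ⟨D, hD⟩ := (((hS.tendsto_nhdsGE_zero x).comp hlim).norm).bddAbove_range
    exact ⟨D, fun n => hD ⟨n, rfl⟩⟩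
  obtain ⟨n, hn⟩ := exists_nat_gt C
  linarith [hC n, ht_norm n]

theorem norm_le_pow (hS : IsC0Semigroup S) {δ C : ℝ} (hδ : 0 ≤ δ) (hC : 1 ≤ C)
    (hbound : ∀ t, 0 ≤ t → t ≤ δ → ‖S t‖ ≤ C) (n : ℕ) {t : ℝ} (ht : 0 ≤ t)
    (htn : t ≤ (n + 1) * δ) : ‖S t‖ ≤ C ^ (n + 1) := by
  induction n generalizing t with
  | zero => simpa using hbound t ht (by simpa using htn)
  | succ n ih =>
    rcases le_total t δ with h | h
    · exact (hbound t ht h).trans (le_self_pow₀ hC (by simp))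
    · have hprev := ih (t := t - δ) (by linarith) (by push_cast at htn; linarith)
      have hadd := hS.map_add δ (t - δ) hδ (by linarith)
      rw [add_sub_cancel] at hadd
      rw [hadd, pow_succ' C (n + 1)]
      exact (ContinuousLinearMap.opNorm_comp_le _ _).trans
        (mul_le_mul (hbound δ hδ le_rfl) hprev (norm_nonneg _) (by linarith))

theorem exists_norm_le_exp [CompleteSpace X] (hS : IsC0Semigroup S) :
    ∃ M ω : ℝ, 0 < M ∧ 0 ≤ ω ∧ ∀ t, 0 ≤ t → ‖S t‖ ≤ M * Real.exp (ω * t) := by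
  obtain ⟨δ, C, hδ, hC, hbound⟩ := hS.exists_norm_le_near_zero
  have hC0 : 0 < C := by linarith
  refine ⟨C, Real.log C / δ, hC0, div_nonneg (Real.log_nonneg hC) hδ.le, fun t ht => ?_⟩
  have hfloor : t ≤ (⌊t / δ⌋₊ + 1) * δ := by
    rw [← div_le_iff₀ hδ]
    exact (Nat.lt_floor_add_one _).le
  calc ‖S t‖ ≤ C ^ (⌊t / δ⌋₊ + 1) := hS.norm_le_pow hδ.le hC hbound _ ht hfloor
    _ = C * Real.exp (Real.log C * ⌊t / δ⌋₊) := by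
        rw [pow_succ', ← Real.rpow_natCast, Real.rpow_def_of_pos hC0]
    _ ≤ C * Real.exp (Real.log C * (t / δ)) := by
        have := Real.log_nonneg hC
        gcongr
        exact Nat.floor_le (by positivity)
    _ = C * Real.exp (Real.log C / δ * t) := by ring_nf

theorem norm_sub_apply_le (hS : IsC0Semigroup S) {s t : ℝ} (hs : 0 ≤ s) (hst : s ≤ t) (x : X) :
    ‖S t x - S s x‖ ≤ ‖S s‖ * ‖S (t - s) x - x‖ := by
  have hadd := hS.map_add s (t - s) hs (by linarith)
  rw [add_sub_cancel] at hadd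
  rw [hadd, ContinuousLinearMap.comp_apply, ← map_sub]
  exact (S s).le_opNorm _

theorem continuousOn_apply [CompleteSpace X] (hS : IsC0Semigroup S) (x : X) :
    ContinuousOn (fun t => S t x) (Set.Ici 0) := by
  obtain ⟨M, ω, hM, hω, hbound⟩ := hS.exists_norm_le_exp
  intro t ht
  have ht : 0 ≤ t := ht
  have hle : ∀ s ∈ Set.Ici (0 : ℝ),
      ‖S s x - S t x‖ ≤ M * Real.exp (ω * t) * ‖S |s - t| x - x‖ := by
    intro s hs
    rcases le_total s t with h | h
    · rw [norm_sub_rev, abs_sub_comm, abs_of_nonneg (sub_nonneg.2 h)]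
      refine (hS.norm_sub_apply_le hs h x).trans ?_
      gcongr
      exact (hbound s hs).trans (by gcongr)
    · rw [abs_of_nonneg (sub_nonneg.2 h)]
      refine (hS.norm_sub_apply_le ht h x).trans ?_
      gcongr
      exact hbound t ht
  have habs : Tendsto (fun s : ℝ => |s - t|) (𝓝[Set.Ici 0] t) (𝓝[≥] 0) := by
    refine tendsto_nhdsWithin_iff.2 ⟨?_, .of_forall fun s => Set.mem_Ici.2 (abs_nonneg _)⟩
    have hcont : Continuous fun s : ℝ => |s - t| := by fun_prop
    simpa using (hcont.tendsto t).mono_left nhdsWithin_le_nhds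
  have hlim : Tendsto (fun s => M * Real.exp (ω * t) * ‖S |s - t| x - x‖) (𝓝[Set.Ici 0] t)
      (𝓝 0) := by
    simpa using ((((hS.tendsto_nhdsGE_zero x).comp habs).sub_const x).norm).const_mul
      (M * Real.exp (ω * t))
  rw [ContinuousWithinAt, tendsto_iff_norm_sub_tendsto_zero]
  refine squeeze_zero' (.of_forall fun _ => norm_nonneg _) ?_ hlim
  filter_upwards [self_mem_nhdsWithin] with s hs using hle s hs

end IsC0Semigroup

/-- A weight on `(0, ∞)` that is continuous and decays faster than every exponential, so that it can
be integrated against any `C₀`-semigroup. -/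
structure IsRapidlyDecaying (k : ℝ → ℝ) : Prop where
  continuousOn : ContinuousOn k (Set.Ioi 0)
  exists_abs_le : ∀ K : ℝ, ∃ C, 0 < C ∧ ∀ ξ, 0 < ξ → |k ξ| ≤ C * Real.exp (-K * ξ)

theorem isRapidlyDecaying_subordDensity {a : ℝ} (ha : 0 < a) (ha' : a < 1) :
    IsRapidlyDecaying (subordDensity a) :=
  ⟨continuousOn_subordDensity ha ha', exists_abs_subordDensity_le ha ha'⟩

namespace IsRapidlyDecaying

variable {k l : ℝ → ℝ} {b : ℝ}

theorem sub (hk : IsRapidlyDecaying k) (hl : IsRapidlyDecaying l) :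
    IsRapidlyDecaying fun ξ => k ξ - l ξ where
  continuousOn := hk.continuousOn.sub hl.continuousOn
  exists_abs_le K := by
    obtain ⟨C, hC, hkC⟩ := hk.exists_abs_le K
    obtain ⟨D, hD, hlD⟩ := hl.exists_abs_le K
    refine ⟨C + D, by positivity, fun ξ hξ => (abs_sub _ _).trans ?_⟩
    rw [add_mul]
    exact add_le_add (hkC ξ hξ) (hlD ξ hξ)

theorem id_mul (hk : IsRapidlyDecaying k) : IsRapidlyDecaying fun ξ => ξ * k ξ where
  continuousOn := continuousOn_id.mul hk.continuousOn
  exists_abs_le K := by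
    obtain ⟨C, hC, hkC⟩ := hk.exists_abs_le (K + 1)
    refine ⟨C, hC, fun ξ hξ => ?_⟩
    have hexp : ξ ≤ Real.exp ξ := by linarith [Real.add_one_le_exp ξ]
    calc |ξ * k ξ| = ξ * |k ξ| := by rw [abs_mul, abs_of_pos hξ]
      _ ≤ Real.exp ξ * (C * Real.exp (-(K + 1) * ξ)) := by
          gcongr
          exact hkC ξ hξ
      _ = C * Real.exp (-K * ξ) := by
          rw [mul_left_comm, ← Real.exp_add]
          ring_nf

theorem exists_abs_dilation_le (hk : IsRapidlyDecaying k) (hb : 0 < b) (K : ℝ) :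
    ∃ C, 0 < C ∧ ∀ c ∈ Set.Ioo (b / 2) (2 * b), ∀ ξ, 0 < ξ →
      |c * k (c * ξ)| ≤ C * Real.exp (-K * ξ) := by
  obtain ⟨C, hC, hkC⟩ := hk.exists_abs_le (2 * |K| / b)
  refine ⟨2 * b * C, by positivity, fun c hc ξ hξ => ?_⟩
  have hc0 : 0 < c := by linarith [hc.1]
  have hrate : K ≤ 2 * |K| / b * c := by
    rw [div_mul_eq_mul_div, le_div_iff₀ hb]
    nlinarith [hc.1, abs_nonneg K, le_abs_self K]
  have hexp : -(2 * |K| / b) * (c * ξ) ≤ -K * ξ := by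
    nlinarith [mul_le_mul_of_nonneg_right hrate hξ.le]
  calc |c * k (c * ξ)| = c * |k (c * ξ)| := by rw [abs_mul, abs_of_pos hc0]
    _ ≤ 2 * b * (C * Real.exp (-(2 * |K| / b) * (c * ξ))) := by
        gcongr
        exacts [hc.2.le, hkC _ (by positivity)]
    _ ≤ 2 * b * (C * Real.exp (-K * ξ)) := by gcongr 2 * b * (C * Real.exp ?_)
    _ = 2 * b * C * Real.exp (-K * ξ) := by ring

theorem dilation (hk : IsRapidlyDecaying k) (hb : 0 < b) :
    IsRapidlyDecaying fun ξ => b * k (b * ξ) where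
  continuousOn := continuousOn_const.mul
    (hk.continuousOn.comp (by fun_prop) fun _ hξ => mul_pos hb hξ)
  exists_abs_le K := by
    obtain ⟨C, hC, hle⟩ := hk.exists_abs_dilation_le hb K
    exact ⟨C, hC, hle b ⟨by linarith, by linarith⟩⟩

theorem integrableOn_abs_mul_exp (hk : IsRapidlyDecaying k) (K : ℝ) :
    IntegrableOn (fun ξ => |k ξ| * Real.exp (K * ξ)) (Set.Ioi 0) := by
  obtain ⟨C, -, hC⟩ := hk.exists_abs_le (K + 1)
  refine ((integrableOn_exp_mul_Ioi (a := -1) (by norm_num) 0).const_mul C).mono'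
    ((hk.continuousOn.abs.mul (by fun_prop)).aestronglyMeasurable measurableSet_Ioi) ?_
  filter_upwards [ae_restrict_mem measurableSet_Ioi] with ξ hξ
  calc ‖|k ξ| * Real.exp (K * ξ)‖ = |k ξ| * Real.exp (K * ξ) :=
        Real.norm_of_nonneg (by positivity)
    _ ≤ C * Real.exp (-(K + 1) * ξ) * Real.exp (K * ξ) := by
        gcongr
        exact hC ξ hξ
    _ = C * Real.exp (-1 * ξ) := by
        rw [mul_assoc, ← Real.exp_add]
        ring_nf

theorem tendsto_integral_abs_dilation_sub (hk : IsRapidlyDecaying k) (hb : 0 < b) (K : ℝ) :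
    Tendsto (fun c => ∫ ξ in Set.Ioi 0, |c * k (c * ξ) - b * k (b * ξ)| * Real.exp (K * ξ))
      (𝓝 b) (𝓝 0) := by
  obtain ⟨C, -, hle⟩ := hk.exists_abs_dilation_le hb (K + 1)
  have hmem : Set.Ioo (b / 2) (2 * b) ∈ 𝓝 b := Ioo_mem_nhds (by linarith) (by linarith)
  have hlim : Tendsto (fun c => ∫ ξ in Set.Ioi (0 : ℝ),
      |c * k (c * ξ) - b * k (b * ξ)| * Real.exp (K * ξ)) (𝓝 b)
      (𝓝 (∫ _ in Set.Ioi (0 : ℝ), 0)) := by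
    refine tendsto_integral_filter_of_dominated_convergence
      (fun ξ => 2 * C * Real.exp (-1 * ξ)) ?_ ?_
      ((integrableOn_exp_mul_Ioi (by norm_num) 0).const_mul _) ?_
    · filter_upwards [lt_mem_nhds hb] with c hc
      exact (((hk.dilation hc).sub (hk.dilation hb)).integrableOn_abs_mul_exp K).1
    · filter_upwards [hmem] with c hc
      filter_upwards [ae_restrict_mem measurableSet_Ioi] with ξ hξ
      calc ‖|c * k (c * ξ) - b * k (b * ξ)| * Real.exp (K * ξ)‖
          = |c * k (c * ξ) - b * k (b * ξ)| * Real.exp (K * ξ) :=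
            Real.norm_of_nonneg (by positivity)
        _ ≤ (C * Real.exp (-(K + 1) * ξ) + C * Real.exp (-(K + 1) * ξ)) * Real.exp (K * ξ) := by
            gcongr
            exact (abs_sub _ _).trans
              (add_le_add (hle c hc ξ hξ) (hle b (mem_of_mem_nhds hmem) ξ hξ))
        _ = 2 * C * (Real.exp (-(K + 1) * ξ) * Real.exp (K * ξ)) := by ring
        _ = 2 * C * Real.exp (-1 * ξ) := by
            rw [← Real.exp_add]
            ring_nf
    · filter_upwards [ae_restrict_mem measurableSet_Ioi] with ξ hξ
      have hcont : ContinuousAt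
          (fun c => |c * k (c * ξ) - b * k (b * ξ)| * Real.exp (K * ξ)) b := by
        have := (hk.continuousOn.continuousAt (Ioi_mem_nhds (mul_pos hb hξ))).comp
          (f := fun c => c * ξ) (by fun_prop)
        exact ((continuousAt_id.mul this).sub continuousAt_const).abs.mul continuousAt_const
      simpa [ContinuousAt] using hcont
  simpa using hlim

end IsRapidlyDecaying

section SemigroupAverage

variable {X : Type*} [NormedAddCommGroup X] [NormedSpace ℝ X] {S : ℝ → X →L[ℝ] X}
  {k l : ℝ → ℝ} {M ω c d : ℝ}

/-- The average `∫₀^∞ k(ξ) S(c ξ) x dξ` of a semigroup, of which both `T_q(t) x` and `T̂_q(t) x` are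
instances with `c = t ^ q`. -/
def semigroupAverage (S : ℝ → X →L[ℝ] X) (k : ℝ → ℝ) (c : ℝ) (x : X) : X :=
  ∫ ξ in Set.Ioi 0, k ξ • S (c * ξ) x

theorem norm_smul_apply_le (hbound : ∀ t, 0 ≤ t → ‖S t‖ ≤ M * Real.exp (ω * t)) (hM : 0 ≤ M)
    (hω : 0 ≤ ω) (hd : 0 ≤ d) (hdc : d ≤ c) {ξ : ℝ} (hξ : 0 ≤ ξ) (x : X) :
    ‖k ξ • S (d * ξ) x‖ ≤ |k ξ| * Real.exp (ω * c * ξ) * (M * ‖x‖) := by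
  calc ‖k ξ • S (d * ξ) x‖ ≤ |k ξ| * (M * Real.exp (ω * (d * ξ)) * ‖x‖) := by
        rw [norm_smul, Real.norm_eq_abs]
        gcongr
        exact (S (d * ξ)).le_of_opNorm_le (hbound _ (by positivity)) x
    _ ≤ |k ξ| * (M * Real.exp (ω * (c * ξ)) * ‖x‖) := by gcongr
    _ = |k ξ| * Real.exp (ω * c * ξ) * (M * ‖x‖) := by ring_nf

theorem norm_semigroupAverage_le (hbound : ∀ t, 0 ≤ t → ‖S t‖ ≤ M * Real.exp (ω * t))
    (hM : 0 ≤ M) (hω : 0 ≤ ω) (hk : IsRapidlyDecaying k) (hd : 0 ≤ d) (hdc : d ≤ c) (x : X) :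
    ‖semigroupAverage S k d x‖ ≤
      (∫ ξ in Set.Ioi 0, |k ξ| * Real.exp (ω * c * ξ)) * M * ‖x‖ := by
  rw [mul_assoc, ← integral_mul_const]
  refine norm_integral_le_of_norm_le ((hk.integrableOn_abs_mul_exp _).mul_const _) ?_
  filter_upwards [ae_restrict_mem measurableSet_Ioi] with ξ hξ
  exact norm_smul_apply_le hbound hM hω hd hdc (le_of_lt hξ) x

theorem semigroupAverage_eq_dilation (hc : 0 < c) (x : X) :
    semigroupAverage S k c x = semigroupAverage S (fun ξ => c⁻¹ * k (c⁻¹ * ξ)) 1 x := by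
  have h := integral_comp_mul_left_Ioi (fun η => k (c⁻¹ * η) • S η x) 0 hc
  simp only [mul_zero, inv_mul_cancel_left₀ hc.ne'] at h
  simp only [semigroupAverage, h, one_mul, mul_smul, integral_smul]

variable [CompleteSpace X]

theorem integrableOn_smul_apply (hS : IsC0Semigroup S) (hk : IsRapidlyDecaying k) (hc : 0 ≤ c)
    (x : X) : IntegrableOn (fun ξ => k ξ • S (c * ξ) x) (Set.Ioi 0) := by
  obtain ⟨M, ω, hM, hω, hbound⟩ := hS.exists_norm_le_exp
  have hcont : ContinuousOn (fun ξ => k ξ • S (c * ξ) x) (Set.Ioi 0) :=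
    hk.continuousOn.smul ((hS.continuousOn_apply x).comp (by fun_prop)
      fun ξ hξ => mul_nonneg hc (le_of_lt hξ))
  refine ((hk.integrableOn_abs_mul_exp (ω * c)).mul_const (M * ‖x‖)).mono'
    (hcont.aestronglyMeasurable measurableSet_Ioi) ?_
  filter_upwards [ae_restrict_mem measurableSet_Ioi] with ξ hξ
  exact norm_smul_apply_le hbound hM.le hω hc le_rfl (le_of_lt hξ) x

theorem semigroupAverage_sub (hS : IsC0Semigroup S) (hk : IsRapidlyDecaying k)
    (hl : IsRapidlyDecaying l) (hc : 0 ≤ c) (x : X) :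
    semigroupAverage S k c x - semigroupAverage S l c x =
      semigroupAverage S (fun ξ => k ξ - l ξ) c x := by
  simp only [semigroupAverage, sub_smul]
  exact (integral_sub (integrableOn_smul_apply hS hk hc x)
    (integrableOn_smul_apply hS hl hc x)).symm

theorem exists_norm_semigroupAverage_le (hS : IsC0Semigroup S) (hk : IsRapidlyDecaying k) (c : ℝ) :
    ∃ D, 0 ≤ D ∧ ∀ d, 0 ≤ d → d ≤ c → ∀ x, ‖semigroupAverage S k d x‖ ≤ D * ‖x‖ := by
  obtain ⟨M, ω, hM, hω, hbound⟩ := hS.exists_norm_le_exp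
  exact ⟨_, mul_nonneg (integral_nonneg fun ξ => by positivity) hM.le,
    fun d hd hdc => norm_semigroupAverage_le hbound hM.le hω hk hd hdc⟩

theorem exists_clm_eq_semigroupAverage (hS : IsC0Semigroup S) (hk : IsRapidlyDecaying k)
    (hc : 0 ≤ c) : ∃ L : X →L[ℝ] X, ∀ x, L x = semigroupAverage S k c x := by
  obtain ⟨D, -, hD⟩ := exists_norm_semigroupAverage_le hS hk c
  refine ⟨LinearMap.mkContinuous
    { toFun := semigroupAverage S k c
      map_add' := fun x y => ?_
      map_smul' := fun r x => ?_ } D (hD c hc le_rfl), fun x => rfl⟩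
  · simp only [semigroupAverage, map_add, smul_add]
    exact integral_add (integrableOn_smul_apply hS hk hc x) (integrableOn_smul_apply hS hk hc y)
  · simp only [semigroupAverage, map_smul, smul_comm _ r, integral_smul, RingHom.id_apply]

theorem continuousOn_semigroupAverage (hS : IsC0Semigroup S) (hk : IsRapidlyDecaying k) (x : X) :
    ContinuousOn (fun c => semigroupAverage S k c x) (Set.Ici 0) := by
  obtain ⟨M, ω, hM, hω, hbound⟩ := hS.exists_norm_le_exp
  intro c (hc : c ∈ Set.Ici 0)
  refine continuousWithinAt_of_dominated
    (bound := fun ξ => |k ξ| * Real.exp (ω * (c + 1) * ξ) * (M * ‖x‖)) ?_ ?_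
    ((hk.integrableOn_abs_mul_exp _).mul_const _) ?_
  · filter_upwards [self_mem_nhdsWithin] with d hd
    exact (integrableOn_smul_apply hS hk hd x).1
  · filter_upwards [self_mem_nhdsWithin, mem_nhdsWithin_of_mem_nhds
      (Iic_mem_nhds (lt_add_one c))] with d hd hdc
    filter_upwards [ae_restrict_mem measurableSet_Ioi] with ξ hξ
    exact norm_smul_apply_le hbound hM.le hω hd hdc (le_of_lt hξ) x
  · filter_upwards [ae_restrict_mem measurableSet_Ioi] with ξ hξ
    have hcomp : ContinuousOn (fun d : ℝ => S (d * ξ) x) (Set.Ici 0) :=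
      (hS.continuousOn_apply x).comp (f := fun d => d * ξ) (s := Set.Ici 0)
        (continuous_id.mul continuous_const).continuousOn
        fun d hd => Set.mem_Ici.2 (mul_nonneg (Set.mem_Ici.1 hd) (le_of_lt hξ))
    exact continuousWithinAt_const.smul (hcomp c hc)

end SemigroupAverage

section Operators

variable {X : Type*} [NormedAddCommGroup X] [NormedSpace ℝ X] [CompleteSpace X]
  {S : ℝ → X →L[ℝ] X} {a : ℝ}

theorem hatT_apply (hS : IsC0Semigroup S) (ha : 0 < a) (ha' : a < 1) {t : ℝ} (ht : 0 ≤ t) (x : X) :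
    hatT S a t x = a • semigroupAverage S (fun ξ => ξ * subordDensity a ξ) (t ^ a) x := by
  obtain ⟨L, hL⟩ := exists_clm_eq_semigroupAverage hS
    (isRapidlyDecaying_subordDensity ha ha').id_mul (Real.rpow_nonneg ht a)
  have hex : ∃ L : X →L[ℝ] X, ∀ x, L x = hatTVec S a t x :=
    ⟨a • L, fun x => congrArg (a • ·) (hL x)⟩
  rw [hatT, dif_pos hex]
  exact hex.choose_spec x

theorem exists_norm_hatT_le (hS : IsC0Semigroup S) (ha : 0 < a) (ha' : a < 1) (T : ℝ) :
    ∃ D : ℝ, ∀ t, 0 ≤ t → t ≤ T → ‖hatT S a t‖ ≤ D := by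
  obtain ⟨D, hD, hle⟩ := exists_norm_semigroupAverage_le hS
    (isRapidlyDecaying_subordDensity ha ha').id_mul (T ^ a)
  refine ⟨a * D, fun t ht htT => ContinuousLinearMap.opNorm_le_bound _ (by positivity) fun x => ?_⟩
  rw [hatT_apply hS ha ha' ht, norm_smul, Real.norm_of_nonneg ha.le, mul_assoc]
  gcongr
  exact hle _ (Real.rpow_nonneg ht a) (Real.rpow_le_rpow ht htT ha.le) x

/-- Dilating the weight instead of the semigroup turns norm continuity of `t ↦ T̂_a(t)`, for which
`S` itself need not be norm continuous, into `L¹`-continuity of the dilations of the weight. -/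
theorem continuousOn_hatT (hS : IsC0Semigroup S) (ha : 0 < a) (ha' : a < 1) :
    ContinuousOn (hatT S a) (Set.Ioi 0) := by
  obtain ⟨M, ω, hM, hω, hbound⟩ := hS.exists_norm_le_exp
  set k : ℝ → ℝ := fun ξ => ξ * subordDensity a ξ
  have hk : IsRapidlyDecaying k := (isRapidlyDecaying_subordDensity ha ha').id_mul
  intro t ht
  have hta : 0 < t ^ a := Real.rpow_pos_of_pos ht a
  have hinv : Tendsto (fun s : ℝ => (s ^ a)⁻¹) (𝓝 t) (𝓝 (t ^ a)⁻¹) :=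
    (Real.continuousAt_rpow_const t a (.inl (ne_of_gt ht))).tendsto.inv₀ hta.ne'
  have hlim := (((hk.tendsto_integral_abs_dilation_sub (inv_pos.2 hta) (ω * 1)).comp
    hinv).mul_const M).const_mul a
  rw [zero_mul, mul_zero] at hlim
  refine ContinuousAt.continuousWithinAt ?_
  rw [ContinuousAt, tendsto_iff_norm_sub_tendsto_zero]
  refine squeeze_zero' (.of_forall fun _ => norm_nonneg _) ?_ hlim
  filter_upwards [Ioi_mem_nhds ht] with s hs
  have hs : 0 < s := hs
  have hsa : 0 < s ^ a := Real.rpow_pos_of_pos hs a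
  refine ContinuousLinearMap.opNorm_le_bound _ (mul_nonneg ha.le
    (mul_nonneg (integral_nonneg fun ξ => by positivity) hM.le)) fun x => ?_
  rw [sub_apply, hatT_apply hS ha ha' hs.le, hatT_apply hS ha ha' (le_of_lt ht), ← smul_sub,
    semigroupAverage_eq_dilation hsa, semigroupAverage_eq_dilation hta,
    semigroupAverage_sub hS (hk.dilation (inv_pos.2 hsa)) (hk.dilation (inv_pos.2 hta))
      zero_le_one, norm_smul, Real.norm_of_nonneg ha.le, mul_assoc]
  gcongr
  exact norm_semigroupAverage_le hbound hM.le hω ((hk.dilation (inv_pos.2 hsa)).sub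
    (hk.dilation (inv_pos.2 hta))) zero_le_one le_rfl x

theorem continuousOn_fracT (hS : IsC0Semigroup S) (ha : 0 < a) (ha' : a < 1) (x : X) :
    ContinuousOn (fun t => fracT S a t x) (Set.Ici 0) :=
  (continuousOn_semigroupAverage hS (isRapidlyDecaying_subordDensity ha ha') x).comp
    (Real.continuous_rpow_const ha.le).continuousOn fun _ ht => Real.rpow_nonneg ht a

end Operators

/-! ### Resolvents of positive semidefinite maps from the dual -/

section Duality

variable {X : Type*} [NormedAddCommGroup X] [NormedSpace ℝ X]

theorem dense_of_forall_dual_eq_zero (V : Submodule ℝ X)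
    (h : ∀ f : StrongDual ℝ X, (∀ v ∈ V, f v = 0) → f = 0) : Dense (V : Set X) := by
  intro x
  by_contra hx
  obtain ⟨f, u, hfu, hux⟩ := geometric_hahn_banach_closed_point V.convex.closure isClosed_closure hx
  have hzero : ∀ v ∈ V, f v = 0 := by
    intro v hv
    by_contra hne
    have hlt := hfu (((u + 1) / f v) • v) (subset_closure (V.smul_mem _ hv))
    rw [map_smul, smul_eq_mul, div_mul_cancel₀ _ hne] at hlt
    linarith
  have hu : f 0 < u := hfu 0 (subset_closure V.zero_mem)
  simp only [h f hzero, zero_apply] at hu hux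
  linarith

theorem norm_eq_of_mem_dualityMap {w : X} {f : StrongDual ℝ X} (hf : f ∈ dualityMap w) :
    ‖f‖ = ‖w‖ :=
  (pow_left_inj₀ (norm_nonneg _) (norm_nonneg _) two_ne_zero).1 hf.2

theorem subsingleton_dualityMap [StrictConvexSpace ℝ (StrongDual ℝ X)] (w : X) :
    (dualityMap w).Subsingleton := by
  intro f hf g hg
  have hfn := norm_eq_of_mem_dualityMap hf
  have hgn := norm_eq_of_mem_dualityMap hg
  refine eq_of_norm_eq_of_norm_add_eq (hfn.trans hgn.symm) (le_antisymm (norm_add_le _ _) ?_)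
  rw [hfn, hgn]
  have hsum : (f + g) w = ‖w‖ ^ 2 + ‖w‖ ^ 2 := by rw [add_apply, hf.1, hg.1]
  have hle : (f + g) w ≤ ‖f + g‖ * ‖w‖ := (le_abs_self _).trans ((f + g).le_opNorm w)
  rcases (norm_nonneg w).eq_or_lt with hw | hw
  · simp [← hw]
  · nlinarith

theorem sq_norm_sub_norm_le_of_mem_dualityMap {w₁ w₂ : X} {f₁ f₂ : StrongDual ℝ X}
    (hf₁ : f₁ ∈ dualityMap w₁) (hf₂ : f₂ ∈ dualityMap w₂) :
    (‖w₁‖ - ‖w₂‖) ^ 2 ≤ (f₁ - f₂) (w₁ - w₂) := by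
  have h₁₂ : f₁ w₂ ≤ ‖f₁‖ * ‖w₂‖ := (le_abs_self _).trans (f₁.le_opNorm w₂)
  have h₂₁ : f₂ w₁ ≤ ‖f₂‖ * ‖w₁‖ := (le_abs_self _).trans (f₂.le_opNorm w₁)
  rw [norm_eq_of_mem_dualityMap hf₁] at h₁₂
  rw [norm_eq_of_mem_dualityMap hf₂] at h₂₁
  rw [sub_apply, map_sub, map_sub, hf₁.1, hf₂.1]
  linarith

theorem dualityMap_eq_of_apply_sub_nonpos [StrictConvexSpace ℝ (StrongDual ℝ X)] {w₁ w₂ : X}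
    {f₁ f₂ : StrongDual ℝ X} (hf₁ : f₁ ∈ dualityMap w₁) (hf₂ : f₂ ∈ dualityMap w₂)
    (hle : (f₁ - f₂) (w₁ - w₂) ≤ 0) : f₁ = f₂ := by
  have hn₁ := norm_eq_of_mem_dualityMap hf₁
  have hn₂ := norm_eq_of_mem_dualityMap hf₂
  have hnorm : ‖w₁‖ = ‖w₂‖ := sub_eq_zero.1 <| (pow_eq_zero_iff two_ne_zero).1 <|
    ((sq_norm_sub_norm_le_of_mem_dualityMap hf₁ hf₂).trans hle).antisymm (sq_nonneg _)
  have h₁₂ : f₁ w₂ ≤ ‖f₁‖ * ‖w₂‖ := (le_abs_self _).trans (f₁.le_opNorm w₂)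
  have h₂₁ : f₂ w₁ ≤ ‖f₂‖ * ‖w₁‖ := (le_abs_self _).trans (f₂.le_opNorm w₁)
  rw [sub_apply, map_sub, map_sub, hf₁.1, hf₂.1, hnorm] at hle
  rw [hn₁, hnorm] at h₁₂
  rw [hn₂, hnorm] at h₂₁
  exact subsingleton_dualityMap w₂ ⟨by linarith, by rw [hn₁, hnorm]⟩ hf₂

theorem mem_dualityMap_of_subgradient {w : X} {f : StrongDual ℝ X}
    (h : ∀ g : StrongDual ℝ X, (g - f) w ≤ 1 / 2 * (‖g‖ ^ 2 - ‖f‖ ^ 2)) : f ∈ dualityMap w := by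
  obtain ⟨g, hg, hgw⟩ := exists_dual_vector'' ℝ w
  have hgw' : (‖w‖ • g) w = ‖w‖ ^ 2 := by
    rw [smul_apply, hgw, smul_eq_mul, sq, RCLike.ofReal_real_eq_id, id]
  have hgn : ‖‖w‖ • g‖ ≤ ‖w‖ := by
    rw [norm_smul, norm_norm]
    exact mul_le_of_le_one_right (norm_nonneg w) hg
  have hlow := h (‖w‖ • g)
  rw [sub_apply, hgw'] at hlow
  have hsq : ‖‖w‖ • g‖ ^ 2 ≤ ‖w‖ ^ 2 := by gcongr
  have hup : f w ≤ ‖f‖ * ‖w‖ := (le_abs_self _).trans (f.le_opNorm w)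
  have hnorm : ‖f‖ = ‖w‖ := by nlinarith
  rw [hnorm] at hlow hup
  exact ⟨by linarith, by rw [hnorm]⟩

theorem lowerSemicontinuous_norm_weakDual :
    LowerSemicontinuous fun f : WeakDual ℝ X => ‖WeakDual.toStrongDual f‖ := by
  rw [lowerSemicontinuous_iff_isClosed_preimage]
  intro y
  convert WeakDual.isClosed_closedBall (0 : StrongDual ℝ X) y using 1
  ext f
  simp only [Set.mem_preimage, Set.mem_Iic, mem_closedBall_zero_iff]

/-- The linear map `Φ : X* → X` is positive semidefinite, i.e. `(f, g) ↦ ⟨Φ g, f⟩` is a symmetric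
positive semidefinite bilinear form on `X*`. -/
structure IsPosSemidef (Φ : StrongDual ℝ X →ₗ[ℝ] X) : Prop where
  symm : ∀ f g : StrongDual ℝ X, f (Φ g) = g (Φ f)
  nonneg : ∀ f : StrongDual ℝ X, 0 ≤ f (Φ f)

/-- The functional `f ↦ (λ/2) ‖f‖² + ½ ⟨Φ f, f⟩ - ⟨h, f⟩` on `X*`, whose Euler–Lagrange equation
is `λ w + Φ f = h` with `f ∈ J[w]`. -/
def resolventEnergy (Φ : StrongDual ℝ X →ₗ[ℝ] X) (lam : ℝ) (h : X) (f : StrongDual ℝ X) : ℝ :=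
  lam / 2 * ‖f‖ ^ 2 + (1 / 2 * f (Φ f) - f h)

variable {Φ : StrongDual ℝ X →ₗ[ℝ] X} {lam : ℝ} {h : X}

namespace IsPosSemidef

theorem solvesResolventEq_unique [StrictConvexSpace ℝ (StrongDual ℝ X)] (hΦ : IsPosSemidef Φ)
    (hlam : 0 < lam) {w₁ w₂ : X} (h₁ : SolvesResolventEq Φ lam h w₁)
    (h₂ : SolvesResolventEq Φ lam h w₂) : w₁ = w₂ := by
  obtain ⟨f₁, hf₁, he₁⟩ := h₁
  obtain ⟨f₂, hf₂, he₂⟩ := h₂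
  have hsub : lam • (w₁ - w₂) + Φ (f₁ - f₂) = 0 := by
    rw [map_sub, smul_sub, sub_add_sub_comm, he₁, he₂, sub_self]
  have hpair : lam * (f₁ - f₂) (w₁ - w₂) + (f₁ - f₂) (Φ (f₁ - f₂)) = 0 := by
    rw [← smul_eq_mul, ← map_smul, ← map_add, hsub, map_zero]
  have hle : (f₁ - f₂) (w₁ - w₂) ≤ 0 :=
    nonpos_of_mul_nonpos_right (by linarith [hΦ.nonneg (f₁ - f₂)]) hlam
  rw [dualityMap_eq_of_apply_sub_nonpos hf₁ hf₂ hle, sub_self, map_zero, add_zero] at hsub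
  exact sub_eq_zero.1 ((smul_eq_zero.1 hsub).resolve_left hlam.ne')

theorem apply_add_smul (hΦ : IsPosSemidef Φ) (f d : StrongDual ℝ X) (s : ℝ) :
    (f + s • d) (Φ (f + s • d)) = f (Φ f) + 2 * s * d (Φ f) + s ^ 2 * d (Φ d) := by
  simp only [map_add, map_smul, add_apply, smul_apply, smul_eq_mul]
  rw [hΦ.symm f d]
  ring

theorem two_mul_apply_le (hΦ : IsPosSemidef Φ) (f g : StrongDual ℝ X) :
    2 * f (Φ g) ≤ f (Φ f) + g (Φ g) := by
  have hsq := hΦ.nonneg (f + (-1 : ℝ) • g)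
  rw [hΦ.apply_add_smul, hΦ.symm g f] at hsq
  linarith

/-- A nonnegative quadratic form is the supremum of its tangent functionals. -/
theorem lowerSemicontinuous_apply (hΦ : IsPosSemidef Φ) :
    LowerSemicontinuous fun f : WeakDual ℝ X =>
      WeakDual.toStrongDual f (Φ (WeakDual.toStrongDual f)) := by
  intro f₀ y hy
  have hcont : Continuous fun f : WeakDual ℝ X => 2 * f (Φ (WeakDual.toStrongDual f₀)) -
      WeakDual.toStrongDual f₀ (Φ (WeakDual.toStrongDual f₀)) :=
    ((WeakDual.eval_continuous _).const_mul 2).sub continuous_const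
  have htangent : y < 2 * f₀ (Φ (WeakDual.toStrongDual f₀)) -
      WeakDual.toStrongDual f₀ (Φ (WeakDual.toStrongDual f₀)) :=
    hy.trans_eq (by simp only [WeakDual.toStrongDual_apply]; ring)
  filter_upwards [hcont.continuousAt.eventually (lt_mem_nhds htangent)] with f hf
  have hle := hΦ.two_mul_apply_le (WeakDual.toStrongDual f) (WeakDual.toStrongDual f₀)
  rw [WeakDual.toStrongDual_apply] at hle
  linarith

theorem lowerSemicontinuous_resolventEnergy (hΦ : IsPosSemidef Φ) (hlam : 0 < lam) (h : X) :
    LowerSemicontinuous fun f : WeakDual ℝ X =>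
      resolventEnergy Φ lam h (WeakDual.toStrongDual f) := by
  have hnorm : LowerSemicontinuous fun f : WeakDual ℝ X =>
      lam / 2 * ‖WeakDual.toStrongDual f‖ ^ 2 := by
    have hmono : Monotone fun r : ℝ => lam / 2 * max r 0 ^ 2 := fun r s hrs => by
      have := le_max_right r 0
      dsimp only
      gcongr
    simpa only [Function.comp_def, max_eq_left (norm_nonneg _)] using
      Continuous.comp_lowerSemicontinuous (by fun_prop) lowerSemicontinuous_norm_weakDual hmono
  have hquad : LowerSemicontinuous fun f : WeakDual ℝ X =>
      1 / 2 * WeakDual.toStrongDual f (Φ (WeakDual.toStrongDual f)) :=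
    Continuous.comp_lowerSemicontinuous (continuous_const_mul (1 / 2 : ℝ))
      hΦ.lowerSemicontinuous_apply (monotone_mul_left_of_nonneg (by positivity))
  have hlin : LowerSemicontinuous fun f : WeakDual ℝ X => -WeakDual.toStrongDual f h :=
    (WeakDual.eval_continuous h).neg.lowerSemicontinuous
  simpa only [resolventEnergy, sub_eq_add_neg] using hnorm.add (hquad.add hlin)

theorem exists_forall_resolventEnergy_le (hΦ : IsPosSemidef Φ) (hlam : 0 < lam) (h : X) :
    ∃ f, ∀ g, resolventEnergy Φ lam h f ≤ resolventEnergy Φ lam h g := by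
  set r := 2 * ‖h‖ / lam with hr
  have hr0 : 0 ≤ r := by positivity
  obtain ⟨f, -, hf⟩ := (hΦ.lowerSemicontinuous_resolventEnergy hlam h).lowerSemicontinuousOn
    (WeakDual.toStrongDual ⁻¹' Metric.closedBall (0 : StrongDual ℝ X) r)
    |>.exists_isMinOn ⟨0, by simpa using hr0⟩ (WeakDual.isCompact_closedBall 0 r)
  have hball : ∀ g : StrongDual ℝ X, ‖g‖ ≤ r →
      resolventEnergy Φ lam h (WeakDual.toStrongDual f) ≤ resolventEnergy Φ lam h g := fun g hg =>
    hf (a := StrongDual.toWeakDual g) (by simpa using hg)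
  refine ⟨WeakDual.toStrongDual f, fun g => ?_⟩
  rcases le_or_gt ‖g‖ r with hg | hg
  · exact hball g hg
  · have hcoercive : g h ≤ lam / 2 * ‖g‖ ^ 2 := by
      rw [hr, div_lt_iff₀ hlam] at hg
      have hgh : g h ≤ ‖g‖ * ‖h‖ := (le_abs_self _).trans (g.le_opNorm h)
      nlinarith [norm_nonneg g]
    calc resolventEnergy Φ lam h (WeakDual.toStrongDual f) ≤ resolventEnergy Φ lam h 0 :=
          hball 0 (by simpa using hr0)
      _ = 0 := by simp [resolventEnergy]
      _ ≤ resolventEnergy Φ lam h g := by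
          unfold resolventEnergy
          linarith [hΦ.nonneg g]

theorem apply_sub_le_of_forall_resolventEnergy_le (hΦ : IsPosSemidef Φ) (hlam : 0 < lam)
    {f : StrongDual ℝ X} (hf : ∀ g, resolventEnergy Φ lam h f ≤ resolventEnergy Φ lam h g)
    (g : StrongDual ℝ X) : (g - f) (h - Φ f) ≤ lam / 2 * (‖g‖ ^ 2 - ‖f‖ ^ 2) := by
  have hquotient : ∀ s ∈ Set.Ioo (0 : ℝ) 1, (g - f) (h - Φ f) ≤
      lam / 2 * (‖g‖ ^ 2 - ‖f‖ ^ 2) + s * (1 / 2 * (g - f) (Φ (g - f))) := by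
    intro s ⟨hs, hs1⟩
    have hconv : ‖f + s • (g - f)‖ ^ 2 ≤ (1 - s) * ‖f‖ ^ 2 + s * ‖g‖ ^ 2 := by
      rw [show f + s • (g - f) = (1 - s) • f + s • g by module]
      exact ((convexOn_norm convex_univ).pow (fun _ _ => norm_nonneg _) 2).2 (Set.mem_univ f)
        (Set.mem_univ g) (by linarith) hs.le (by ring)
    have hmin := hf (f + s • (g - f))
    have hlin : (f + s • (g - f)) h = f h + s * (g - f) h := rfl
    unfold resolventEnergy at hmin
    rw [hΦ.apply_add_smul, hlin] at hmin
    rw [map_sub]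
    refine le_of_mul_le_mul_left ?_ hs
    linarith [mul_le_mul_of_nonneg_left hconv (by positivity : 0 ≤ lam / 2)]
  have hlim : Tendsto (fun s : ℝ => lam / 2 * (‖g‖ ^ 2 - ‖f‖ ^ 2) +
      s * (1 / 2 * (g - f) (Φ (g - f)))) (𝓝[>] 0) (𝓝 (lam / 2 * (‖g‖ ^ 2 - ‖f‖ ^ 2))) := by
    refine ((Continuous.tendsto' (by fun_prop) 0 _ (by ring)).mono_left nhdsWithin_le_nhds)
  exact ge_of_tendsto hlim (eventually_of_mem (Ioo_mem_nhdsGT one_pos) hquotient)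

theorem solvesResolventEq_of_forall_resolventEnergy_le (hΦ : IsPosSemidef Φ) (hlam : 0 < lam)
    {f : StrongDual ℝ X} (hf : ∀ g, resolventEnergy Φ lam h f ≤ resolventEnergy Φ lam h g) :
    SolvesResolventEq Φ lam h (lam⁻¹ • (h - Φ f)) := by
  refine ⟨f, mem_dualityMap_of_subgradient fun g => ?_, ?_⟩
  · rw [map_smul, smul_eq_mul, inv_mul_le_iff₀ hlam]
    linarith [hΦ.apply_sub_le_of_forall_resolventEnergy_le hlam hf g]
  · rw [smul_inv_smul₀ hlam.ne', sub_add_cancel]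

theorem existsUnique_solvesResolventEq [StrictConvexSpace ℝ (StrongDual ℝ X)]
    (hΦ : IsPosSemidef Φ) (hlam : 0 < lam) (h : X) : ∃! w, SolvesResolventEq Φ lam h w := by
  obtain ⟨f, hf⟩ := hΦ.exists_forall_resolventEnergy_le hlam h
  have hsolves := hΦ.solvesResolventEq_of_forall_resolventEnergy_le hlam hf
  exact ⟨_, hsolves, fun w hw => hΦ.solvesResolventEq_unique hlam hw hsolves⟩

theorem sq_norm_smul_le_of_solvesResolventEq (hΦ : IsPosSemidef Φ) (hlam : 0 < lam) {w : X}
    (hw : SolvesResolventEq Φ lam h w) (g : StrongDual ℝ X) :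
    ‖lam • w‖ ^ 2 ≤ lam * (1 / 2 * g (Φ g)) + ‖h - Φ g‖ * ‖lam • w‖ := by
  obtain ⟨f, hf, he⟩ := hw
  have hpair : lam * ‖w‖ ^ 2 + f (Φ f) = f (h - Φ g) + f (Φ g) := by
    rw [← map_add, sub_add_cancel, ← he, map_add, map_smul, hf.1, smul_eq_mul]
  have hle : f (h - Φ g) ≤ ‖w‖ * ‖h - Φ g‖ := by
    rw [← norm_eq_of_mem_dualityMap hf]
    exact (le_abs_self _).trans (f.le_opNorm _)
  have hbound : lam * ‖w‖ ^ 2 ≤ ‖w‖ * ‖h - Φ g‖ + 1 / 2 * g (Φ g) := by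
    linarith [hΦ.nonneg f, hΦ.two_mul_apply_le f g]
  rw [norm_smul, Real.norm_of_nonneg hlam.le]
  linarith [mul_le_mul_of_nonneg_left hbound hlam.le]

theorem tendsto_smul_of_denseRange (hΦ : IsPosSemidef Φ) (hdense : DenseRange Φ) {R : ℝ → X}
    (hR : ∀ lam, 0 < lam → SolvesResolventEq Φ lam h (R lam)) :
    Tendsto (fun lam : ℝ => lam • R lam) (𝓝[>] 0) (𝓝 0) := by
  rw [Metric.tendsto_nhds]
  intro ε hε
  obtain ⟨g, hg⟩ := hdense.exists_dist_lt h (half_pos hε)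
  rw [dist_eq_norm] at hg
  have hsmall : ∀ᶠ lam : ℝ in 𝓝[>] 0, lam * (1 / 2 * g (Φ g)) < ε ^ 2 / 2 :=
    ((continuous_mul_const (1 / 2 * g (Φ g))).tendsto' 0 0 (zero_mul _)
      |>.eventually_lt_const (half_pos (pow_pos hε 2))).filter_mono nhdsWithin_le_nhds
  filter_upwards [hsmall, self_mem_nhdsWithin] with lam hlam_small hlam
  have hsq := hΦ.sq_norm_smul_le_of_solvesResolventEq hlam (hR lam hlam) g
  rw [dist_zero_right]
  by_contra! hge
  nlinarith [mul_le_mul_of_nonneg_right hg.le (norm_nonneg (lam • R lam))]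

end IsPosSemidef

theorem denseRange_of_tendsto_smul {R : ℝ → X → X}
    (hR : ∀ lam, 0 < lam → ∀ h, SolvesResolventEq Φ lam h (R lam h))
    (hlim : ∀ h, Tendsto (fun lam : ℝ => lam • R lam h) (𝓝[>] 0) (𝓝 0)) : DenseRange Φ := by
  intro h
  have hconv : Tendsto (fun lam : ℝ => h - lam • R lam h) (𝓝[>] 0) (𝓝 h) := by
    simpa using (hlim h).const_sub h
  refine mem_closure_of_tendsto hconv ?_
  filter_upwards [self_mem_nhdsWithin] with lam hlam
  obtain ⟨f, -, hf⟩ := hR lam hlam h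
  exact ⟨f, eq_sub_of_add_eq' hf⟩

theorem IsPosSemidef.denseRange_iff_tendsto_smul_resolventOp
    [StrictConvexSpace ℝ (StrongDual ℝ X)] (hΦ : IsPosSemidef Φ) :
    DenseRange Φ ↔ ∀ h, Tendsto (fun lam : ℝ => lam • resolventOp Φ lam h) (𝓝[>] 0) (𝓝 0) := by
  have hR : ∀ lam, 0 < lam → ∀ h, SolvesResolventEq Φ lam h (resolventOp Φ lam h) :=
    fun lam hlam h => Classical.epsilon_spec (hΦ.existsUnique_solvesResolventEq hlam h).exists
  exact ⟨fun hdense h => hΦ.tendsto_smul_of_denseRange hdense fun lam hlam => hR lam hlam h,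
    denseRange_of_tendsto_smul hR⟩

end Duality

/-! ### Square-integrable operator kernels -/

section Adjoint

variable {X U : Type*} [NormedAddCommGroup X] [NormedSpace ℝ X]
  [NormedAddCommGroup U] [InnerProductSpace ℝ U] [CompleteSpace U]

theorem inner_adjointB (B : U →L[ℝ] X) (f : StrongDual ℝ X) (u : U) :
    inner ℝ (adjointB B f) u = f (B u) := by
  rw [adjointB, InnerProductSpace.toDual_symm_apply, ContinuousLinearMap.comp_apply]

theorem adjointB_add (B : U →L[ℝ] X) (f g : StrongDual ℝ X) :
    adjointB B (f + g) = adjointB B f + adjointB B g := by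
  rw [adjointB, ContinuousLinearMap.add_comp, map_add, adjointB, adjointB]

theorem adjointB_smul (B : U →L[ℝ] X) (r : ℝ) (f : StrongDual ℝ X) :
    adjointB B (r • f) = r • adjointB B f := by
  rw [adjointB, ContinuousLinearMap.smul_comp, map_smulₛₗ, adjointB, conj_trivial]

theorem norm_adjointB_le (B : U →L[ℝ] X) (f : StrongDual ℝ X) : ‖adjointB B f‖ ≤ ‖f‖ * ‖B‖ := by
  rw [adjointB, LinearIsometryEquiv.norm_map]
  exact ContinuousLinearMap.opNorm_comp_le _ _

theorem continuous_adjointB_left (f : StrongDual ℝ X) :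
    Continuous fun B : U →L[ℝ] X => adjointB B f :=
  (InnerProductSpace.toDual ℝ U).symm.continuous.comp
    (ContinuousLinearMap.compL ℝ U X ℝ f).continuous

end Adjoint

section Kernel

variable {X U : Type*} [NormedAddCommGroup X] [NormedSpace ℝ X]
  [NormedAddCommGroup U] [InnerProductSpace ℝ U]
  {Ω : Type*} [MeasurableSpace Ω] {μ : Measure Ω} {κ : Ω → U →L[ℝ] X}

theorem integrable_kernel_apply (hκ : MemLp κ 2 μ) {u : Ω → U} (hu : MemLp u 2 μ) :
    Integrable (fun s => κ s (u s)) μ :=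
  (hκ.norm.integrable_mul hu.norm).mono'
    ((ContinuousLinearMap.id ℝ (U →L[ℝ] X)).aestronglyMeasurable_comp₂ hκ.1 hu.1)
    (.of_forall fun s => (κ s).le_opNorm (u s))

/-- The range of the integral operator `u ↦ ∫ κ(s) u(s) dμ(s)` on `L²(μ; U)`. -/
def kernelRange (hκ : MemLp κ 2 μ) : Submodule ℝ X where
  carrier := {y | ∃ u : Ω → U, MemLp u 2 μ ∧ ∫ s, κ s (u s) ∂μ = y}
  zero_mem' := ⟨0, MemLp.zero, by simp⟩
  add_mem' := by
    rintro _ _ ⟨u, hu, rfl⟩ ⟨v, hv, rfl⟩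
    refine ⟨u + v, hu.add hv, ?_⟩
    simp only [Pi.add_apply, map_add]
    exact integral_add (integrable_kernel_apply hκ hu) (integrable_kernel_apply hκ hv)
  smul_mem' := by
    rintro r _ ⟨u, hu, rfl⟩
    refine ⟨r • u, hu.const_smul r, ?_⟩
    simp only [Pi.smul_apply, map_smul]
    exact integral_smul _ _

variable [CompleteSpace U]

theorem memLp_adjointB (hκ : MemLp κ 2 μ) (f : StrongDual ℝ X) :
    MemLp (fun s => adjointB (κ s) f) 2 μ :=
  hκ.of_le_mul (c := ‖f‖) ((continuous_adjointB_left f).comp_aestronglyMeasurable hκ.1)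
    (.of_forall fun s => norm_adjointB_le (κ s) f)

/-- The Gramian `f ↦ ∫ κ(s) κ(s)* f dμ(s)` of a square-integrable kernel, i.e. the composition of
the integral operator `u ↦ ∫ κ(s) u(s) dμ(s)` with its adjoint. -/
def kernelGramian (hκ : MemLp κ 2 μ) : StrongDual ℝ X →ₗ[ℝ] X where
  toFun f := ∫ s, κ s (adjointB (κ s) f) ∂μ
  map_add' f g := by
    simp only [adjointB_add, map_add]
    exact integral_add (integrable_kernel_apply hκ (memLp_adjointB hκ f))
      (integrable_kernel_apply hκ (memLp_adjointB hκ g))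
  map_smul' r f := by
    simp only [adjointB_smul, map_smul, RingHom.id_apply]
    exact integral_smul _ _

variable [CompleteSpace X]

theorem dual_integral_kernel_apply (hκ : MemLp κ 2 μ) {u : Ω → U} (hu : MemLp u 2 μ)
    (f : StrongDual ℝ X) :
    f (∫ s, κ s (u s) ∂μ) = ∫ s, inner ℝ (adjointB (κ s) f) (u s) ∂μ := by
  rw [← ContinuousLinearMap.integral_comp_comm f (integrable_kernel_apply hκ hu)]
  simp only [inner_adjointB]

theorem dual_kernelGramian (hκ : MemLp κ 2 μ) (f g : StrongDual ℝ X) :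
    f (kernelGramian hκ g) = ∫ s, inner ℝ (adjointB (κ s) f) (adjointB (κ s) g) ∂μ :=
  dual_integral_kernel_apply hκ (memLp_adjointB hκ g) f

theorem isPosSemidef_kernelGramian (hκ : MemLp κ 2 μ) : IsPosSemidef (kernelGramian hκ) where
  symm f g := by simp only [dual_kernelGramian, real_inner_comm]
  nonneg f := by
    rw [dual_kernelGramian]
    exact integral_nonneg fun s => real_inner_self_nonneg

theorem adjointB_ae_eq_zero_of_kernelGramian (hκ : MemLp κ 2 μ) {f : StrongDual ℝ X}
    (hf : f (kernelGramian hκ f) = 0) : ∀ᵐ s ∂μ, adjointB (κ s) f = 0 := by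
  rw [dual_kernelGramian] at hf
  simp only [real_inner_self_eq_norm_sq] at hf
  have hinteg : Integrable (fun s => ‖adjointB (κ s) f‖ ^ 2) μ :=
    (memLp_two_iff_integrable_sq_norm (memLp_adjointB hκ f).1).1 (memLp_adjointB hκ f)
  filter_upwards [(integral_eq_zero_iff_of_nonneg (fun s => by positivity) hinteg).1 hf] with s hs
  simpa using hs

theorem denseRange_kernelGramian (hκ : MemLp κ 2 μ)
    (h : ∀ f : StrongDual ℝ X, (∀ᵐ s ∂μ, adjointB (κ s) f = 0) → f = 0) :
    DenseRange (kernelGramian hκ) := by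
  rw [DenseRange, ← LinearMap.coe_range]
  exact dense_of_forall_dual_eq_zero _ fun f hf =>
    h f (adjointB_ae_eq_zero_of_kernelGramian hκ (hf _ ⟨f, rfl⟩))

theorem eq_zero_of_dense_kernelRange (hκ : MemLp κ 2 μ) (h : Dense (kernelRange hκ : Set X))
    {f : StrongDual ℝ X} (hf : ∀ᵐ s ∂μ, adjointB (κ s) f = 0) : f = 0 := by
  have hvanish : Set.EqOn f (0 : StrongDual ℝ X) (kernelRange hκ : Set X) := by
    rintro _ ⟨u, hu, rfl⟩
    rw [dual_integral_kernel_apply hκ hu, zero_apply]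
    refine integral_eq_zero_of_ae ?_
    filter_upwards [hf] with s hs
    rw [hs, inner_zero_left, Pi.zero_apply]
  exact DFunLike.coe_injective (Continuous.ext_on h f.continuous continuous_const hvanish)

theorem dense_kernelRange_iff_denseRange_kernelGramian (hκ : MemLp κ 2 μ) :
    Dense (kernelRange hκ : Set X) ↔ DenseRange (kernelGramian hκ) := by
  refine ⟨fun h => denseRange_kernelGramian hκ fun f => eq_zero_of_dense_kernelRange hκ h,
    fun h => h.mono ?_⟩
  rintro _ ⟨f, rfl⟩
  exact ⟨_, memLp_adjointB hκ f, rfl⟩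

theorem dense_kernelRange_iff_forall_dual (hκ : MemLp κ 2 μ) :
    Dense (kernelRange hκ : Set X) ↔
      ∀ f : StrongDual ℝ X, (∀ᵐ s ∂μ, adjointB (κ s) f = 0) → f = 0 :=
  ⟨fun h _ => eq_zero_of_dense_kernelRange hκ h, fun h =>
    (dense_kernelRange_iff_denseRange_kernelGramian hκ).2 (denseRange_kernelGramian hκ h)⟩

end Kernel

/-! ### Continuity of convolutions -/

section Convolution

open scoped Convolution ENNReal

theorem memLp_comp_sub_left_Ioc {E : Type*} [NormedAddCommGroup E] {p : ℝ≥0∞} {T : ℝ} {g : ℝ → E}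
    (hg : MemLp g p (volume.restrict (Set.Ioc 0 T))) :
    MemLp (fun s => g (T - s)) p (volume.restrict (Set.Ioc 0 T)) := by
  rw [← restrict_Ioo_eq_restrict_Ioc] at hg ⊢
  have hreflect := (Measure.measurePreserving_sub_left volume T).restrict_preimage
    (measurableSet_Ioo (a := 0) (b := T))
  rw [Set.preimage_const_sub_Ioo, sub_self, sub_zero] at hreflect
  exact hg.comp_measurePreserving hreflect

variable {G E F H : Type*} [NormedAddCommGroup E] [NormedSpace ℝ E] [NormedAddCommGroup F]
  [NormedSpace ℝ F] [NormedAddCommGroup H] [NormedSpace ℝ H] [CompleteSpace H]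
  {p q : ℝ≥0∞} [p.HolderConjugate q]

theorem continuous_convolution_of_memLp [AddCommGroup G] [TopologicalSpace G]
    [IsTopologicalAddGroup G] [R1Space G] [MeasurableSpace G] [BorelSpace G] {μ : Measure G}
    [μ.IsAddLeftInvariant] [μ.IsNegInvariant] [IsLocallyFiniteMeasure μ]
    [μ.InnerRegularCompactLTTop] (hq : q ≠ ∞) (L : E →L[ℝ] F →L[ℝ] H) {f : G → E} {g : G → F}
    (hf : MemLp f p μ) (hg : MemLp g q μ) : Continuous (f ⋆[L, μ] g) := by
  have : Fact (1 ≤ p) := ⟨ENNReal.HolderConjugate.one_le p q⟩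
  have : Fact (1 ≤ q) := ⟨ENNReal.HolderConjugate.one_le q p⟩
  have : Fact (q ≠ ∞) := ⟨hq⟩
  have hneg : MemLp (fun s => g (-s)) q μ :=
    hg.comp_measurePreserving (Measure.measurePreserving_neg μ)
  have hpairing (t : G) : (f ⋆[L, μ] g) t =
      L.lpPairing μ p q hf.toLp (DomAddAct.mk (-t) +ᵥ hneg.toLp) := by
    have htranslate : MemLp (fun s => g (t - s)) q μ :=
      hg.comp_measurePreserving (Measure.measurePreserving_sub_left μ t)
    have hLp : htranslate.toLp = DomAddAct.mk (-t) +ᵥ hneg.toLp := by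
      rw [DomAddAct.mk_vadd_toLp]
      congr 1
      ext s
      simp only [vadd_eq_add, neg_add, neg_neg, sub_eq_add_neg]
    rw [← hLp, ContinuousLinearMap.lpPairing_eq_integral]
    refine integral_congr_ae ?_
    filter_upwards [hf.coeFn_toLp, htranslate.coeFn_toLp] with s hfs hgs
    rw [hfs, hgs]
  have htranslation : Continuous fun t : G => (DomAddAct.mk (-t) +ᵥ hneg.toLp : Lp F q μ) :=
    (DomAddAct.continuous_mk.comp continuous_neg).vadd continuous_const
  rw [funext hpairing]
  exact (L.lpPairing μ p q hf.toLp).continuous.comp htranslation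

theorem continuousOn_intervalIntegral_apply_sub {T : ℝ} (hq : q ≠ ∞) (L : E →L[ℝ] F →L[ℝ] H)
    {f : ℝ → E} {g : ℝ → F} (hf : MemLp f p (volume.restrict (Set.Ioc 0 T)))
    (hg : MemLp g q (volume.restrict (Set.Ioc 0 T))) :
    ContinuousOn (fun t => ∫ s in (0 : ℝ)..t, L (f s) (g (t - s))) (Set.Icc 0 T) := by
  have hcont := continuous_convolution_of_memLp hq L
    ((memLp_indicator_iff_restrict measurableSet_Ioc).2 hf)
    ((memLp_indicator_iff_restrict measurableSet_Ioc).2 hg)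
  refine hcont.continuousOn.congr fun t ht => ?_
  rw [intervalIntegral.integral_of_le ht.1, integral_Ioc_eq_integral_Ioo,
    ← integral_indicator measurableSet_Ioo]
  refine integral_congr_ae (.of_forall fun s => ?_)
  dsimp only
  by_cases hs : s ∈ Set.Ioo 0 t
  · have hf_mem : s ∈ Set.Ioc 0 T := ⟨hs.1, hs.2.le.trans ht.2⟩
    have hg_mem : t - s ∈ Set.Ioc 0 T := ⟨sub_pos.2 hs.2, by linarith [hs.1, ht.2]⟩
    simp only [Set.indicator_of_mem hs, Set.indicator_of_mem hf_mem, Set.indicator_of_mem hg_mem]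
  · rw [Set.indicator_of_notMem hs]
    rcases not_and_or.1 hs with hs | hs
    · rw [Set.indicator_of_notMem fun h => hs h.1, map_zero, zero_apply]
    · have hg_notMem : t - s ∉ Set.Ioc 0 T := fun h => hs (sub_pos.1 h.1)
      rw [Set.indicator_of_notMem hg_notMem, map_zero]

end Convolution

/-! ### The control system -/

theorem memLp_rpow_Ioc {a : ℝ} (ha : 1 / 2 < a) (T : ℝ) :
    MemLp (fun r : ℝ => r ^ (a - 1)) 2 (volume.restrict (Set.Ioc 0 T)) := by
  have hmeas : AEStronglyMeasurable (fun r : ℝ => r ^ (a - 1)) (volume.restrict (Set.Ioc 0 T)) :=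
    (measurable_id.pow_const _).aestronglyMeasurable
  have hint : IntegrableOn (fun r : ℝ => r ^ ((a - 1) * 2)) (Set.Ioc 0 T) :=
    (intervalIntegral.intervalIntegrable_rpow' (by linarith)).1
  refine (memLp_two_iff_integrable_sq hmeas).2
    (hint.congr_fun (fun r hr => ?_) measurableSet_Ioc)
  dsimp only
  rw [Real.rpow_mul hr.1.le, Real.rpow_two]

section System

variable {X U : Type*} [NormedAddCommGroup X] [NormedSpace ℝ X]
  [NormedAddCommGroup U] [InnerProductSpace ℝ U] {S : ℝ → X →L[ℝ] X} {B : U →L[ℝ] X} {a T : ℝ}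

/-- The kernel `r ^ (a - 1) T̂_a(r) B` of the operator sending a control to its contribution to the
mild solution. -/
def controlKernel (S : ℝ → X →L[ℝ] X) (B : U →L[ℝ] X) (a r : ℝ) : U →L[ℝ] X :=
  r ^ (a - 1) • (hatT S a r).comp B

theorem adjointB_controlKernel [CompleteSpace U] (r : ℝ) (f : StrongDual ℝ X) :
    adjointB (controlKernel S B a r) f = r ^ (a - 1) • obsOp S B a r f := by
  rw [obsOp, ← adjointB_smul, adjointB, adjointB, controlKernel, ContinuousLinearMap.comp_smul,
    ContinuousLinearMap.smul_comp, ContinuousLinearMap.comp_assoc]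

variable [CompleteSpace X]

theorem memLp_controlKernel (hS : IsC0Semigroup S) (ha : 1 / 2 < a) (ha' : a < 1) :
    MemLp (controlKernel S B a) 2 (volume.restrict (Set.Ioc 0 T)) := by
  have ha0 : 0 < a := by linarith
  obtain ⟨D, hD⟩ := exists_norm_hatT_le hS ha0 ha' T
  have hcont : ContinuousOn (controlKernel S B a) (Set.Ioc 0 T) :=
    (continuousOn_id.rpow_const fun r hr => Or.inl (ne_of_gt hr.1)).smul
      (((continuousOn_hatT hS ha0 ha').mono Set.Ioc_subset_Ioi_self).clm_comp continuousOn_const)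
  refine (memLp_rpow_Ioc ha T).of_le_mul (c := D * ‖B‖)
    (hcont.aestronglyMeasurable measurableSet_Ioc) ?_
  filter_upwards [ae_restrict_mem measurableSet_Ioc] with r hr
  rw [controlKernel, norm_smul, mul_comm]
  gcongr
  exact (ContinuousLinearMap.opNorm_comp_le _ _).trans (by gcongr; exact hD r hr.1.le hr.2)

theorem memLp_controlKernel_sub (hS : IsC0Semigroup S) (ha : 1 / 2 < a) (ha' : a < 1)
    (B : U →L[ℝ] X) (T : ℝ) :
    MemLp (fun s => controlKernel S B a (T - s)) 2 (volume.restrict (Set.Ioc 0 T)) :=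
  memLp_comp_sub_left_Ioc (memLp_controlKernel hS ha ha')

theorem exists_isMildSolution (hS : IsC0Semigroup S) (ha : 1 / 2 < a) (ha' : a < 1)
    (ζ : X) {u : ℝ → U} (hu : MemLp u 2 (volume.restrict (Set.Ioc 0 T))) :
    ∃ x, IsMildSolution S B a T ζ u x := by
  have hfree : ContinuousOn (fun t => fracT S a t ζ) (Set.Icc 0 T) :=
    (continuousOn_fracT hS (by linarith) ha' ζ).mono Set.Icc_subset_Ici_self
  have hforced : ContinuousOn (fun t => ∫ s in (0 : ℝ)..t, controlKernel S B a (t - s) (u s))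
      (Set.Icc 0 T) := by
    have h := continuousOn_intervalIntegral_apply_sub (p := 2) (q := 2) ENNReal.ofNat_ne_top
      (ContinuousLinearMap.apply ℝ X) hu (memLp_controlKernel (B := B) hS ha ha')
    simpa only [ContinuousLinearMap.apply_apply] using h
  exact ⟨fun t => fracT S a t ζ + ∫ s in (0 : ℝ)..t, controlKernel S B a (t - s) (u s),
    hfree.add hforced, fun _ _ => rfl⟩

theorem reachableSet_eq (hS : IsC0Semigroup S) (ha : 1 / 2 < a) (ha' : a < 1) (hT : 0 ≤ T)
    (ζ : X) :
    reachableSet S B a T ζ = (fun y => fracT S a T ζ + y) ''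
      (kernelRange (memLp_controlKernel_sub hS ha ha' B T) : Set X) := by
  have hIcc : volume.restrict (Set.Icc 0 T) = volume.restrict (Set.Ioc 0 T) :=
    restrict_Ioc_eq_restrict_Icc.symm
  have hfinal {u : ℝ → U} {x : ℝ → X} (hx : IsMildSolution S B a T ζ u x) :
      x T = fracT S a T ζ + ∫ s in Set.Ioc 0 T, controlKernel S B a (T - s) (u s) :=
    (hx.2 T ⟨hT, le_rfl⟩).trans (by rw [intervalIntegral.integral_of_le hT]; rfl)
  ext y
  constructor
  · rintro ⟨u, x, hu, hx, rfl⟩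
    exact ⟨_, ⟨u, hIcc ▸ hu, rfl⟩, (hfinal hx).symm⟩
  · rintro ⟨_, ⟨u, hu, rfl⟩, rfl⟩
    obtain ⟨x, hx⟩ := exists_isMildSolution (B := B) hS ha ha' ζ hu
    exact ⟨u, x, hIcc ▸ hu, hx, hfinal hx⟩

theorem approxControllableFrom_iff (hS : IsC0Semigroup S) (ha : 1 / 2 < a) (ha' : a < 1)
    (hT : 0 ≤ T) (ζ : X) :
    ApproxControllableFrom S B a T ζ ↔
      Dense (kernelRange (memLp_controlKernel_sub hS ha ha' B T) : Set X) := by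
  rw [ApproxControllableFrom, ← dense_iff_closure_eq, reachableSet_eq hS ha ha' hT]
  exact (Homeomorph.addLeft (fracT S a T ζ)).isDenseEmbedding.dense_image

variable [CompleteSpace U]

theorem gramian_eq_kernelGramian (hS : IsC0Semigroup S) (ha : 1 / 2 < a) (ha' : a < 1)
    (hT : 0 ≤ T) :
    gramian S B a T = kernelGramian (memLp_controlKernel_sub hS ha ha' B T) := by
  funext f
  refine (intervalIntegral.integral_of_le hT).trans
    (setIntegral_congr_fun measurableSet_Ioc fun s hs => ?_)
  dsimp only
  rw [adjointB_controlKernel, controlKernel, map_smul, smul_apply, smul_smul,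
    ContinuousLinearMap.comp_apply, ← sq, ← Real.rpow_mul_natCast (sub_nonneg.2 hs.2), mul_comm,
    Nat.cast_ofNat]

theorem continuousOn_obsOp (hS : IsC0Semigroup S) (ha : 0 < a) (ha' : a < 1) (B : U →L[ℝ] X)
    (f : StrongDual ℝ X) : ContinuousOn (fun r => obsOp S B a r f) (Set.Ioi 0) :=
  (continuous_adjointB_left f).comp_continuousOn
    ((continuousOn_hatT hS ha ha').clm_comp (continuousOn_const (c := B))) |>.congr fun r _ => by
      rw [obsOp, adjointB, ContinuousLinearMap.comp_assoc]; rfl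

theorem adjointB_controlKernel_ae_eq_zero_iff (hS : IsC0Semigroup S) (ha : 0 < a) (ha' : a < 1)
    (f : StrongDual ℝ X) :
    (∀ᵐ s ∂(volume.restrict (Set.Ioc 0 T)), adjointB (controlKernel S B a (T - s)) f = 0) ↔
      ∀ t : ℝ, 0 ≤ t → t < T → obsOp S B a (T - t) f = 0 := by
  have hsmul {s : ℝ} (hs : s < T) :
      adjointB (controlKernel S B a (T - s)) f = 0 ↔ obsOp S B a (T - s) f = 0 := by
    rw [adjointB_controlKernel,
      smul_eq_zero_iff_right (Real.rpow_pos_of_pos (sub_pos.2 hs) _).ne']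
  have hcont : ContinuousOn (fun t => obsOp S B a (T - t) f) (Set.Ico 0 T) :=
    (continuousOn_obsOp hS ha ha' B f).comp (f := fun t : ℝ => T - t) (by fun_prop)
      fun s hs => sub_pos.2 hs.2
  rw [← restrict_Ico_eq_restrict_Ioc]
  constructor
  · intro h t ht htT
    refine Measure.eqOn_Ico_of_ae_eq volume (g := fun _ => 0) ?_ hcont continuousOn_const ⟨ht, htT⟩
    filter_upwards [h, ae_restrict_mem measurableSet_Ico] with s hs hsT
    exact (hsmul hsT.2).1 hs
  · intro h
    filter_upwards [ae_restrict_mem measurableSet_Ico] with s hs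
    exact (hsmul hs.2).2 (h s hs.1 hs.2)

theorem dense_kernelRange_iff_H0 [StrictConvexSpace ℝ (StrongDual ℝ X)] (hS : IsC0Semigroup S)
    (ha : 1 / 2 < a) (ha' : a < 1) (hT : 0 ≤ T) :
    Dense (kernelRange (memLp_controlKernel_sub hS ha ha' B T) : Set X) ↔ H0 S B a T := by
  rw [dense_kernelRange_iff_denseRange_kernelGramian,
    (isPosSemidef_kernelGramian _).denseRange_iff_tendsto_smul_resolventOp,
    ← gramian_eq_kernelGramian hS ha ha' hT, H0]

theorem dense_kernelRange_iff_forall_obsOp (hS : IsC0Semigroup S) (ha : 1 / 2 < a) (ha' : a < 1) :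
    Dense (kernelRange (memLp_controlKernel_sub hS ha ha' B T) : Set X) ↔
      ∀ f : StrongDual ℝ X, (∀ t : ℝ, 0 ≤ t → t < T → obsOp S B a (T - t) f = 0) → f = 0 := by
  simp only [dense_kernelRange_iff_forall_dual,
    adjointB_controlKernel_ae_eq_zero_iff hS (one_half_pos.trans ha) ha']

theorem existsUnique_solvesResolventEq_gramian [StrictConvexSpace ℝ (StrongDual ℝ X)]
    (hS : IsC0Semigroup S) (ha : 1 / 2 < a) (ha' : a < 1) (hT : 0 ≤ T) {lam : ℝ} (hlam : 0 < lam)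
    (h : X) : ∃! w, SolvesResolventEq (gramian S B a T) lam h w := by
  rw [gramian_eq_kernelGramian hS ha ha' hT]
  exact (isPosSemidef_kernelGramian _).existsUnique_solvesResolventEq hlam h

end System

end FracControl

end

open FracControl in
theorem lemma3p3_general {X U : Type*}
    [NormedAddCommGroup X] [NormedSpace ℝ X] [CompleteSpace X]
    [StrictConvexSpace ℝ (StrongDual ℝ X)]
    [NormedAddCommGroup U] [InnerProductSpace ℝ U] [CompleteSpace U]
    (S : ℝ → X →L[ℝ] X) (hS : IsC0Semigroup S)
    (B : U →L[ℝ] X) (α T : ℝ) (hα : 1 / 2 < α) (hα' : α < 1) (hT : 0 ≤ T) :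
    (∀ t : ℝ, 0 ≤ t → ∀ x : X,
      IntegrableOn (fun ξ : ℝ => (ξ * subordDensity α ξ) • S (t ^ α * ξ) x)
        (Set.Ioi 0) ∧
      hatT S α t x =
        α • ∫ ξ in Set.Ioi (0 : ℝ), (ξ * subordDensity α ξ) • S (t ^ α * ξ) x) ∧
    (∀ lam : ℝ, 0 < lam → ∀ h : X,
      ∃! w : X, SolvesResolventEq (gramian S B α T) lam h w) ∧
    (ApproxControllable S B α T ↔ H0 S B α T) ∧
    (∀ ζ : X, ApproxControllableFrom S B α T ζ ↔ H0 S B α T) ∧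
    (ApproxControllable S B α T ↔
      ∀ f : StrongDual ℝ X,
        (∀ t : ℝ, 0 ≤ t → t < T → obsOp S B α (T - t) f = 0) → f = 0) := by
  have hα0 : 0 < α := one_half_pos.trans hα
  have hdense (ζ : X) := approxControllableFrom_iff (B := B) hS hα hα' hT ζ
  have hdense_all : ApproxControllable S B α T ↔ _ := (forall_congr' hdense).trans (forall_const X)
  have hH0 := dense_kernelRange_iff_H0 (B := B) hS hα hα' hT
  refine ⟨fun t ht x => ⟨?_, hatT_apply hS hα0 hα' ht x⟩,
    fun _ => existsUnique_solvesResolventEq_gramian hS hα hα' hT, hdense_all.trans hH0,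
    fun ζ => (hdense ζ).trans hH0,
    hdense_all.trans (dense_kernelRange_iff_forall_obsOp hS hα hα')⟩
  exact integrableOn_smul_apply hS (isRapidlyDecaying_subordDensity hα0 hα').id_mul
    (Real.rpow_nonneg ht α) x

theorem lemma3p3 {X U : Type*}
    [NormedAddCommGroup X] [NormedSpace ℝ X] [CompleteSpace X]
    [TopologicalSpace.SeparableSpace X]
    (hrefl : Function.Surjective (NormedSpace.inclusionInDoubleDual ℝ X))
    [StrictConvexSpace ℝ (StrongDual ℝ X)]
    [NormedAddCommGroup U] [InnerProductSpace ℝ U] [CompleteSpace U]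
    [TopologicalSpace.SeparableSpace U]
    (A : X →ₗ.[ℝ] X) (S : ℝ → X →L[ℝ] X) (hS : FracControl.IsC0Semigroup S)
    (hA : FracControl.IsInfinitesimalGenerator A S)
    (B : U →L[ℝ] X) (α T : ℝ) (hα : 1 / 2 < α) (hα' : α < 1) (hT : 0 < T) :
    -- the operators `T̂_α(t)` are well defined, bounded and given by their integral formula
    (∀ t : ℝ, 0 ≤ t → ∀ x : X,
      IntegrableOn (fun ξ : ℝ => (ξ * FracControl.subordDensity α ξ) • S (t ^ α * ξ) x)
        (Set.Ioi 0) ∧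
      FracControl.hatT S α t x =
        α • ∫ ξ in Set.Ioi (0 : ℝ), (ξ * FracControl.subordDensity α ξ) • S (t ^ α * ξ) x) ∧
    -- the resolvent `(λ I + Φ₀ᵀ J)⁻¹` is a well-defined single-valued map on `X`
    (∀ lam : ℝ, 0 < lam → ∀ h : X,
      ∃! w : X, FracControl.SolvesResolventEq (FracControl.gramian S B α T) lam h w) ∧
    -- approximate controllability is equivalent to (H0)
    (FracControl.ApproxControllable S B α T ↔ FracControl.H0 S B α T) ∧
    -- the same for each fixed initial state
    (∀ ζ : X, FracControl.ApproxControllableFrom S B α T ζ ↔ FracControl.H0 S B α T) ∧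
    -- and equivalent to the dual uniqueness condition
    (FracControl.ApproxControllable S B α T ↔
      ∀ f : StrongDual ℝ X,
        (∀ t : ℝ, 0 ≤ t → t < T → FracControl.obsOp S B α (T - t) f = 0) → f = 0) :=
  lemma3p3_general S hS B α T hα hα' hT.le
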